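/- Let $[u]$ denote one of the following functions on $\mathbb{C}$: the Weierstrass sigma function $\sigma(u)$ of an arbitrary lattice of rank two (elliptic case), $\sinh u$ (trigonometric case), or $u$ (rational case). Put $$\zeta(u)=\frac{[u]'}{[u]},\qquad \wp(u)=\frac{([u]')^2-[u]\,[u]''}{[u]^2},$$ $$F(u,h)=\frac{[u-k_2][h-k_2-u][k_3-k_1][h-k_1-k_3]}{[u-k_1][h-k_1-u][k_3-k_2][h-k_2-k_3]},$$ $$\hat F(u,h)=\zeta(k_3-k_1)+\zeta(h-k_1-k_3)-\zeta(u-k_1)-\zeta(h-k_1-u),$$ $$\hat{\hat F}(u,h)=\zeta(h-2k_3)-\zeta(u-k_3)-\zeta(h-k_3-u).$$ Consider the triplet-pair systems $$F_{II}:\quad x_0x_1x_2=y_0y_1y_2,\qquad x_0+x_1+x_2=y_0+y_1+y_2,$$ $$F_{IV}:\quad x_0+x_1+x_2=y_0+y_1+y_2,\qquad x_0^2+x_1^2+x_2^2=y_0^2+y_1^2+y_2^2.$$ Let $1<m\le n$ be integers and let $S$ be one of these systems. For $1\le j\le n$ let $\sigma_j$ be the rational mapping of the variables $x_1,\dots,x_n,y_1,\dots,y_n$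 that leaves $x_j$ and $y_1,\dots,y_n$ unaltered and replaces $x_i$ by $\bar x_i$ for $i\neq j$, where $\bar x_i,\bar y_i$ are determined by imposing $S$ on the pair of triplets $(y_j,x_i,\bar x_i)$, $(x_j,y_i,\bar y_i)$. Let $\omega$ interchange $x_i$ and $y_i$ for all $i$, and put $$t_1=\omega,\quad t_2=\sigma_1\omega\sigma_1,\quad t_3=\omega\sigma_1\sigma_2\omega\sigma_2\sigma_1\omega,\quad t_{i+3}=(\omega\sigma_i\sigma_{i+1})^3\quad (1\le i\le m-1),$$ products of mappings being products of substitutions. Let $t_1,\dots,t_{m+2}$ also act linearly on complex parameters $h_1,h_2,k_1,\dots,k_{n+3}$ by $$t_1=\{h_1\leftrightarrow h_2\},\qquad t_2=\{h_i\mapsto h_i+\beta,\ k_{i\le 4}\mapsto k_i+\beta\},\quad \beta=h_1+h_2-k_1-k_2-k_3-k_4,$$ $$t_3=\{h_1\mapsto h_1+h_2-k_4-k_5,\ k_4\mapsto h_2-k_5,\ k_5\mapsto h_2-k_4\},\qquad t_j=\{k_{j+1}\leftrightarrow k_j\}\quad (4\le j\le m+2).$$ Then the following hold. (1) $\hat F$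 and $\hat{\hat F}$ are the successive degenerations of $F$: as $k_2\to k_1$, $$F(u,h)=1+(k_2-k_1)\hat F(u,h)+O\big((k_2-k_1)^2\big)$$ whenever $[k_3-k_1]$, $[h-k_1-k_3]$, $[u-k_1]$, $[h-k_1-u]$ are nonzero; and as $k_1\to k_3$, $k_1\ne k_3$, $$\hat F(u,h)=\frac{1}{k_3-k_1}+\hat{\hat F}(u,h)+O(k_3-k_1)$$ whenever $[h-2k_3]$, $[u-k_3]$, $[h-k_3-u]$ are nonzero. Moreover $$\hat{\hat F}(u,h)=\frac12\,\frac{\wp'(u-k_3)-\wp'(h-k_3-u)}{\wp(u-k_3)-\wp(h-k_3-u)}$$ whenever $[u-k_3]$, $[h-k_3-u]$ and the denominator are nonzero. (2) For $S=F_{II}$, the substitution $x_i=\hat F(k_{i+3},h_1)$, $y_i=\hat F(k_{i+3},h_2)$ $(1\le i\le n)$ makes the actions of $t_1,\dots,t_{m+2}$ on the variables compatible with their linear actions restricted to the subspace $k_2=k_1$. (3) For $S=F_{IV}$, the substitution $x_i=\hat{\hat F}(k_{i+3},h_1)$, $y_i=\hat{\hat F}(k_{i+3},h_2)$ $(1\le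 i\le n)$ makes the actions of $t_1,\dots,t_{m+2}$ on the variables compatible with their linear actions restricted to the subspace $k_1=k_2=k_3$. Here compatibility of $t_j$ on a subspace $V$ of the parameter space means the following. The linear action of $t_j$ preserves $V$. Let $D\subseteq V$ be the set of those $p\in V$ such that no $\zeta$ in the substitution is evaluated at a zero of $[\,\cdot\,]$, either at $p$ or at $t_j(p)$, and such that every $\sigma_i$ occurring in the composition that defines $t_j$ is determined (its defining equations have a unique solution) when this composition is applied, factor by factor, to the variables substituted at $p$. Then $D$ is relatively open and dense in $V$. For every $p\in D$, the variables substituted at the transformed parameters $t_j(p)$ are the image under the mapping $t_j$ of the variables substituted at $p$. -/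

import Mathlib

open scoped Topology
open Asymptotics

noncomputable section

namespace TripletPair

/-! ### The function `[u]` and the associated `ζ` and `℘` -/

/-- The Weierstrass sigma function of the lattice `L`,
`σ(z) = z ∏_{l ∈ L, l ≠ 0} (1 - z/l) exp (z/l + z²/(2l²))`
(the factor belonging to `l = 0` equals `1` by the convention `a / 0 = 0`). -/
def weierstrassSigma (L : PeriodPair) (z : ℂ) : ℂ :=
  z * ∏' l : L.lattice, (1 - z / (l : ℂ)) * Complex.exp (z / (l : ℂ) + z ^ 2 / (2 * (l : ℂ) ^ 2))

/-- The admissible functions `[u]`: elliptic, trigonometric and rational case. -/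
def IsBracket (f : ℂ → ℂ) : Prop :=
  (∃ L : PeriodPair, f = weierstrassSigma L) ∨ f = Complex.sinh ∨ f = fun u => u

/-- `ζ(u) = [u]' / [u]`. -/
def zetaFn (f : ℂ → ℂ) (u : ℂ) : ℂ := deriv f u / f u

/-- `℘(u) = (([u]')² - [u] [u]'') / [u]²`. -/
def wpFn (f : ℂ → ℂ) (u : ℂ) : ℂ := ((deriv f u) ^ 2 - f u * deriv (deriv f) u) / (f u) ^ 2

/-! ### The function `F` and its two degenerations -/

/-- The function `F(u, h)`, depending on the parameters `k₁, k₂, k₃`. -/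
def bigF (f : ℂ → ℂ) (k₁ k₂ k₃ u h : ℂ) : ℂ :=
  (f (u - k₂) * f (h - k₂ - u) * f (k₃ - k₁) * f (h - k₁ - k₃)) /
    (f (u - k₁) * f (h - k₁ - u) * f (k₃ - k₂) * f (h - k₂ - k₃))

/-- The first degeneration `F̂(u, h)`, depending on `k₁ = k₂` and `k₃`. -/
def hatF (f : ℂ → ℂ) (k₁ k₃ u h : ℂ) : ℂ :=
  zetaFn f (k₃ - k₁) + zetaFn f (h - k₁ - k₃) - zetaFn f (u - k₁) - zetaFn f (h - k₁ - u)

/-- The second degeneration of `F`, depending on `k₁ = k₂ = k₃`. -/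
def hathatF (f : ℂ → ℂ) (k₃ u h : ℂ) : ℂ :=
  zetaFn f (h - 2 * k₃) - zetaFn f (u - k₃) - zetaFn f (h - k₃ - u)

/-! ### Triplet-pair systems and the birational actions -/

/-- A system of equations `S x₀ x₁ x₂ y₀ y₁ y₂` relating two triplets of variables. -/
abbrev System : Type := ℂ → ℂ → ℂ → ℂ → ℂ → ℂ → Prop

/-- The system `x₀x₁x₂ = y₀y₁y₂`, `x₀+x₁+x₂ = y₀+y₁+y₂`. -/
def systemII : System := fun x₀ x₁ x₂ y₀ y₁ y₂ =>
  x₀ * x₁ * x₂ = y₀ * y₁ * y₂ ∧ x₀ + x₁ + x₂ = y₀ + y₁ + y₂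

/-- The system `x₀+x₁+x₂ = y₀+y₁+y₂`, `x₀²+x₁²+x₂² = y₀²+y₁²+y₂²`. -/
def systemIV : System := fun x₀ x₁ x₂ y₀ y₁ y₂ =>
  x₀ + x₁ + x₂ = y₀ + y₁ + y₂ ∧ x₀ ^ 2 + x₁ ^ 2 + x₂ ^ 2 = y₀ ^ 2 + y₁ ^ 2 + y₂ ^ 2

/-- The values of the variables `x₁, …, xₙ` and `y₁, …, yₙ`; the entry with index `i : Fin n`
is the variable with number `i + 1`. -/
abbrev Config (n : ℕ) : Type := (Fin n → ℂ) × (Fin n → ℂ)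

/-- The mapping `σ_j`, as a partial map: it is defined where, for every `i ≠ j`, the system imposed
on the triplets `(y_j, x_i, x̄_i)`, `(x_j, y_i, ȳ_i)` determines `x̄_i` and `ȳ_i`. It replaces `x_i`
by `x̄_i` for `i ≠ j` and leaves `x_j` and all the `y_i` unaltered. -/
def sigmaMap {n : ℕ} (S : System) (j : Fin n) : Config n →. Config n := fun P =>
  { Dom := ∀ i : Fin n, i ≠ j → ∃! q : ℂ × ℂ, S (P.2 j) (P.1 i) q.1 (P.1 j) (P.2 i) q.2
    get := fun hP =>
      (fun i => if hi : i = j then P.1 i else (hP i hi).choose.1, P.2) }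

/-- The mapping `ω` interchanging the `x` and `y` variables. -/
def omegaMap {n : ℕ} : Config n →. Config n := fun P => Part.some (P.2, P.1)

/-- The product of substitutions: as maps on points, the factors are applied from left to right. -/
def mulMap {n : ℕ} (a b : Config n →. Config n) : Config n →. Config n := b.comp a

/-- The mappings `t₀, …, t_{m+2}`:
`t₀ = σ₁`, `t₁ = ω`, `t₂ = σ₁ ω σ₁`, `t₃ = ω σ₁ σ₂ ω σ₂ σ₁ ω` and
`t_{i+3} = (ω σ_i σ_{i+1})³` for `i = 1, …, m - 1`. -/
def tMap {m n : ℕ} (hm : 1 < m) (hmn : m ≤ n) (S : System) : Fin (m + 3) → (Config n →. Config n)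
  | ⟨0, _⟩ => sigmaMap S ⟨0, by omega⟩
  | ⟨1, _⟩ => omegaMap
  | ⟨2, _⟩ =>
      let s₁ : Config n →. Config n := sigmaMap S ⟨0, by omega⟩
      mulMap s₁ (mulMap omegaMap s₁)
  | ⟨3, _⟩ =>
      let s₁ : Config n →. Config n := sigmaMap S ⟨0, by omega⟩
      let s₂ : Config n →. Config n := sigmaMap S ⟨1, by omega⟩
      mulMap omegaMap (mulMap s₁ (mulMap s₂ (mulMap omegaMap (mulMap s₂ (mulMap s₁ omegaMap)))))
  | ⟨i + 4, hi⟩ =>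
      let r : Config n →. Config n :=
        mulMap omegaMap (mulMap (sigmaMap S ⟨i, by omega⟩) (sigmaMap S ⟨i + 1, by omega⟩))
      mulMap r (mulMap r r)

/-! ### The linear actions -/

/-- The values of the parameters `h₁, h₂` and `k₁, …, k_{n+3}`; as above, `h_i` and `k_i` are the
entries with index `i - 1`. -/
abbrev Params (n : ℕ) : Type := (Fin 2 → ℂ) × (Fin (n + 3) → ℂ)

/-- The linear action of `t₁, …, t_{m+2}` on the parameters. No linear action belongs to `t₀`; the
value at index `0` is a placeholder. -/
def linMap {m n : ℕ} (hm : 1 < m) (hmn : m ≤ n) : Fin (m + 3) → Params n → Params n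
  | ⟨0, _⟩ => fun p => p
  | ⟨1, _⟩ => fun p => (![p.1 1, p.1 0], p.2)
  | ⟨2, _⟩ => fun p =>
      let β : ℂ := p.1 0 + p.1 1 - p.2 0 - p.2 1 - p.2 2 - p.2 ⟨3, by omega⟩
      (fun a => p.1 a + β, fun i => if (i : ℕ) < 4 then p.2 i + β else p.2 i)
  | ⟨3, _⟩ => fun p =>
      let k₄ : ℂ := p.2 ⟨3, by omega⟩
      let k₅ : ℂ := p.2 ⟨4, by omega⟩
      (![p.1 0 + p.1 1 - k₄ - k₅, p.1 1],
        fun i => if (i : ℕ) = 3 then p.1 1 - k₅ else if (i : ℕ) = 4 then p.1 1 - k₄ else p.2 i)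
  | ⟨j + 4, hj⟩ => fun p =>
      (p.1, fun i => p.2 (Equiv.swap ⟨j + 3, by omega⟩ ⟨j + 4, by omega⟩ i))

/-! ### The substitutions -/

/-- The special case `k₂ = k₁` of the parameters. -/
def paramsII (n : ℕ) : Set (Params n) := {p | p.2 1 = p.2 0}

/-- The special case `k₁ = k₂ = k₃` of the parameters. -/
def paramsIV (n : ℕ) : Set (Params n) := {p | p.2 0 = p.2 1 ∧ p.2 1 = p.2 2}

/-- `x_i = F̂(k_{i+3}, h₁)`, `y_i = F̂(k_{i+3}, h₂)`. -/
def substII {n : ℕ} (f : ℂ → ℂ) (p : Params n) : Config n :=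
  (fun i => hatF f (p.2 0) (p.2 2) (p.2 (i.addNat 3)) (p.1 0),
   fun i => hatF f (p.2 0) (p.2 2) (p.2 (i.addNat 3)) (p.1 1))

/-- The parameters at which no `ζ` occurring in `substII` is evaluated at a zero of `[u]`. -/
def regularII (f : ℂ → ℂ) (n : ℕ) : Set (Params n) :=
  {p | f (p.2 2 - p.2 0) ≠ 0 ∧ (∀ a : Fin 2, f (p.1 a - p.2 0 - p.2 2) ≠ 0) ∧
    ∀ i : Fin n, f (p.2 (i.addNat 3) - p.2 0) ≠ 0 ∧
      ∀ a : Fin 2, f (p.1 a - p.2 0 - p.2 (i.addNat 3)) ≠ 0}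

/-- The substitution of `x_i`, `y_i` by the second degeneration of `F` at `(k_{i+3}, h₁)`,
`(k_{i+3}, h₂)`. -/
def substIV {n : ℕ} (f : ℂ → ℂ) (p : Params n) : Config n :=
  (fun i => hathatF f (p.2 2) (p.2 (i.addNat 3)) (p.1 0),
   fun i => hathatF f (p.2 2) (p.2 (i.addNat 3)) (p.1 1))

/-- The parameters at which no `ζ` occurring in `substIV` is evaluated at a zero of `[u]`. -/
def regularIV (f : ℂ → ℂ) (n : ℕ) : Set (Params n) :=
  {p | (∀ a : Fin 2, f (p.1 a - 2 * p.2 2) ≠ 0) ∧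
    ∀ i : Fin n, f (p.2 (i.addNat 3) - p.2 2) ≠ 0 ∧
      ∀ a : Fin 2, f (p.1 a - p.2 2 - p.2 (i.addNat 3)) ≠ 0}

/-- The partial map `t` on the variables is compatible, under the substitution `sub`, with the map
`T` on the parameters restricted to `V`: `T` preserves `V`, and `sub (T p) = t (sub p)` for all
`p ∈ V` such that `sub` is regular at `p` and at `T p` and `t` is defined at `sub p`. These
parameters `p` form a relatively open and dense subset of `V`. -/
def Compatible {n : ℕ} (V regular : Set (Params n)) (sub : Params n → Config n)
    (t : Config n →. Config n) (T : Params n → Params n) : Prop :=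
  let D : Set (Params n) := {p | p ∈ V ∧ p ∈ regular ∧ T p ∈ regular ∧ (t (sub p)).Dom}
  (∀ p ∈ V, T p ∈ V) ∧ (∀ p ∈ D, sub (T p) ∈ t (sub p)) ∧
    (∃ U : Set (Params n), IsOpen U ∧ D = U ∩ V) ∧ V ⊆ closure D

end TripletPair

end

open TripletPair

/-! All three functions `[u]` are entire and odd, have derivative 1 at 0, and satisfy one addition
theorem: for a + b = c + d, ζ(a) + ζ(b) - ζ(c) - ζ(d) = [a+b][a-c][c-b] / ([a][b][c][d]).
`SigmaLike` records this with denominators cleared, and everything later uses only these properties.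
For sinh and u the theorem is a direct calculation. For σ it follows from Liouville's theorem, with
quasi-periodicity deduced from the periodicity of ℘ = -(log σ)''.

The addition theorem writes F̂ as a quotient of products of `[·]`. Each `σ_j` is then induced by an
explicit linear involution `sigmaParams j` of the parameters: it permutes the arguments of ζ up to
sign, and turns x_i into a closed expression `barII` that visibly solves the system
(`systemII_hatF`). The system determines the new variables exactly when a determinant is nonzero,
and by the three-term relation (`hatF_det`) this determinant is a quotient of products of `[linear
form]`. System IV is the limit of system II as k₁ tends to k₃: all six variables then contain the
same divergent summand (`systemIV_of_tendsto`).

The mappings `t_j` are words in `ω` and the `σ_j`. The notion `Realizes` includes that regularity at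
p together with definedness of the mapping gives regularity at the image, so it is closed under
products (`Realizes.mul`). The domain stays relatively open and dense because each letter acts on
the subspace by a homeomorphism. It remains to compare each word in the involutions with the
prescribed linear action (`Realizes.tMap`). -/

namespace TripletPair

open Filter

/-! ### The Weierstrass product -/

/-- The primary factor `(1 - z/l) exp (z/l + z²/(2l²))`. -/
noncomputable def primaryFactor (l z : ℂ) : ℂ :=
  (1 - z / l) * Complex.exp (z / l + z ^ 2 / (2 * l ^ 2))

lemma differentiable_primaryFactor (l : ℂ) : Differentiable ℂ (primaryFactor l) := by
  unfold primaryFactor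
  fun_prop

lemma primaryFactor_zero_left (z : ℂ) : primaryFactor 0 z = 1 := by simp [primaryFactor]

lemma primaryFactor_zero_right (l : ℂ) : primaryFactor l 0 = 1 := by simp [primaryFactor]

lemma primaryFactor_ne_zero {l z : ℂ} (h : z ≠ l) : primaryFactor l z ≠ 0 := by
  rcases eq_or_ne l 0 with rfl | hl
  · simp [primaryFactor]
  · refine mul_ne_zero ?_ (Complex.exp_ne_zero _)
    rw [sub_ne_zero, ne_eq, eq_comm, div_eq_one_iff_eq hl]
    exact h

lemma primaryFactor_neg_neg (l z : ℂ) : primaryFactor (-l) (-z) = primaryFactor l z := by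
  simp [primaryFactor]

/-- The exponent is chosen so that the derivative of (1 - w) exp(w + w²/2) reduces to -w² exp(w +
w²/2). The mean value inequality then gives a deviation of third order. -/
lemma norm_primaryFactor_one_sub_one_le {w : ℂ} (hw : ‖w‖ ≤ 1) :
    ‖primaryFactor 1 w - 1‖ ≤ Real.exp 2 * ‖w‖ ^ 3 := by
  have hd : ∀ x : ℂ, HasDerivAt (primaryFactor 1) (-x ^ 2 * Complex.exp (x + x ^ 2 / 2)) x := by
    intro x
    have h1 : HasDerivAt (fun z : ℂ => 1 - z) (-1) x := by
      simpa using (hasDerivAt_id x).const_sub 1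
    have h2 : HasDerivAt (fun z : ℂ => z + z ^ 2 / 2) (1 + x) x := by
      have := (hasDerivAt_id x).add (((hasDerivAt_id x).pow 2).div_const 2)
      refine this.congr_deriv ?_
      simp
    have h3 := h1.mul h2.cexp
    refine (h3.congr_deriv ?_).congr_of_eventuallyEq (Eventually.of_forall fun z => ?_)
    · ring
    · simp [primaryFactor]
  have key := (convex_closedBall (0 : ℂ) ‖w‖).norm_image_sub_le_of_norm_hasDerivWithin_le
    (f := primaryFactor 1) (f' := fun x => -x ^ 2 * Complex.exp (x + x ^ 2 / 2))
    (C := Real.exp 2 * ‖w‖ ^ 2) (x := 0) (y := w)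
    (fun x _ => (hd x).hasDerivWithinAt) ?_ (by simp) (by simp)
  · rw [primaryFactor_zero_right, sub_zero] at key
    calc _ ≤ _ := key
      _ = _ := by ring
  · intro x hx
    have hx' : ‖x‖ ≤ ‖w‖ := by simpa using hx
    have hx1 : ‖x‖ ≤ 1 := hx'.trans hw
    rw [norm_mul, norm_neg, norm_pow, mul_comm]
    have : ‖Complex.exp (x + x ^ 2 / 2)‖ ≤ Real.exp 2 := by
      refine (Complex.norm_exp_le_exp_norm _).trans (Real.exp_le_exp.mpr ?_)
      have h2 : ‖x ^ 2 / 2‖ ≤ 1 := by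
        rw [norm_div, norm_pow]
        simp only [Complex.norm_ofNat]
        nlinarith [norm_nonneg x]
      linarith [norm_add_le x (x ^ 2 / 2)]
    gcongr

lemma norm_primaryFactor_sub_one_le {l z : ℂ} (h : ‖z‖ ≤ ‖l‖) :
    ‖primaryFactor l z - 1‖ ≤ Real.exp 2 * (‖z‖ ^ 3 * ‖l‖ ^ (-3 : ℝ)) := by
  rcases eq_or_ne l 0 with rfl | hl
  · simp only [primaryFactor_zero_left, sub_self, norm_zero]
    positivity
  · have hl' : 0 < ‖l‖ := norm_pos_iff.mpr hl
    have h1 : primaryFactor l z = primaryFactor 1 (z / l) := by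
      simp only [primaryFactor, div_one, one_pow, mul_one]
      congr 3
      field_simp
    have h2 : ‖z / l‖ ≤ 1 := by rw [norm_div, div_le_one hl']; exact h
    rw [h1]
    refine (norm_primaryFactor_one_sub_one_le h2).trans_eq ?_
    have h3 : ‖l‖ ^ (-3 : ℝ) = (‖l‖ ^ 3)⁻¹ := by
      rw [Real.rpow_neg hl'.le]; norm_cast
    rw [norm_div, div_pow, h3, div_eq_mul_inv]

section WeierstrassSigma

variable (L : PeriodPair)

/-- The exponent 3 exceeds the rank 2 of the lattice, so this majorant yields normal convergence of
the product on discs. -/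
lemma summable_bound (r : ℝ) :
    Summable fun l : L.lattice => Real.exp 2 * (r ^ 3 * ‖(l : ℂ)‖ ^ (-3 : ℝ)) :=
  ((ZLattice.summable_norm_rpow L.lattice (-3) (by simp; norm_num)).mul_left _).mul_left _

lemma eventually_norm_primaryFactor_sub_one_le (r : ℝ) :
    ∀ᶠ l : L.lattice in cofinite, ∀ z ∈ Metric.closedBall (0 : ℂ) r,
      ‖primaryFactor l z - 1‖ ≤ Real.exp 2 * (r ^ 3 * ‖(l : ℂ)‖ ^ (-3 : ℝ)) := by
  -- The bound can fail only at lattice points of norm at most r, and these are finitely many.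
  refine (isCompact_iff_finite.mp (isCompact_closedBall (0 : L.lattice) r)).subset ?_
  intro l hl
  by_contra hlr
  refine hl fun z hz => ?_
  have hz' : ‖z‖ ≤ r := by simpa using hz
  have hl' : r < ‖(l : ℂ)‖ := by simpa using hlr
  refine (norm_primaryFactor_sub_one_le (hz'.trans hl'.le)).trans ?_
  gcongr

/-- The product of the primary factors over the lattice. -/
noncomputable def latticeProd (z : ℂ) : ℂ := ∏' l : L.lattice, primaryFactor l z

lemma weierstrassSigma_eq (z : ℂ) : weierstrassSigma L z = z * latticeProd L z := rfl

lemma hasProdLocallyUniformlyOn_latticeProd :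
    HasProdLocallyUniformlyOn (fun (l : L.lattice) z => primaryFactor l z) (latticeProd L)
      Set.univ := by
  refine hasProdLocallyUniformlyOn_of_forall_compact isOpen_univ fun K _ hK => ?_
  obtain ⟨r, hr⟩ := hK.isBounded.subset_closedBall 0
  have := Summable.hasProdUniformlyOn_one_add (f := fun (l : L.lattice) z => primaryFactor l z - 1)
    hK (summable_bound L r)
    ((eventually_norm_primaryFactor_sub_one_le L r).mono fun l hl z hz => hl z (hr hz))
    fun l => ((differentiable_primaryFactor l).continuous.sub continuous_const).continuousOn
  simpa only [add_sub_cancel] using! this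

lemma tendstoLocallyUniformlyOn_latticeProd :
    TendstoLocallyUniformlyOn (fun (s : Finset L.lattice) z => ∏ l ∈ s, primaryFactor l z)
      (latticeProd L) atTop Set.univ :=
  hasProdLocallyUniformlyOn_iff_tendstoLocallyUniformlyOn.mp
    (hasProdLocallyUniformlyOn_latticeProd L)

lemma differentiable_latticeProd : Differentiable ℂ (latticeProd L) := by
  rw [← differentiableOn_univ]
  exact (tendstoLocallyUniformlyOn_latticeProd L).differentiableOn
    (.of_forall fun s => (Differentiable.fun_finsetProd fun (l : L.lattice) _ =>
      differentiable_primaryFactor (l : ℂ)).differentiableOn) isOpen_univ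

lemma latticeProd_zero : latticeProd L 0 = 1 := by
  simp [latticeProd, primaryFactor_zero_right]

lemma latticeProd_neg (z : ℂ) : latticeProd L (-z) = latticeProd L z := by
  simp only [latticeProd]
  rw [← (Equiv.neg L.lattice).tprod_eq]
  simp [primaryFactor_neg_neg]

lemma latticeProd_ne_zero {z : ℂ} (hz : z ∉ L.lattice) : latticeProd L z ≠ 0 := by
  have := tprod_one_add_ne_zero_of_summable (f := fun l : L.lattice => primaryFactor l z - 1)
    (fun l => by
      rw [add_sub_cancel]
      exact primaryFactor_ne_zero fun h => hz (h ▸ l.2))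
    ((summable_bound L ‖z‖).of_norm_bounded_eventually
      ((eventually_norm_primaryFactor_sub_one_le L ‖z‖).mono fun l hl => by
        simpa using hl z (by simp)))
  simpa only [add_sub_cancel] using! this

/-! ### The function `℘` of a product -/

/-- Where the function does not vanish, `wpFn` is minus the second logarithmic derivative, hence
additive on products. -/
lemma wpFn_mul {f g : ℂ → ℂ} (hf : Differentiable ℂ f) (hg : Differentiable ℂ g) {z : ℂ}
    (hfz : f z ≠ 0) (hgz : g z ≠ 0) :
    wpFn (fun z => f z * g z) z = wpFn f z + wpFn g z := by
  have h1 : deriv (fun z => f z * g z) = fun z => deriv f z * g z + f z * deriv g z :=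
    funext fun x => deriv_fun_mul (hf x) (hg x)
  have h2 : deriv (deriv fun z => f z * g z) z =
      deriv (deriv f) z * g z + deriv f z * deriv g z +
        (deriv f z * deriv g z + f z * deriv (deriv g) z) := by
    rw [h1, deriv_fun_add ((hf.deriv z).fun_mul (hg z)) ((hf z).fun_mul (hg.deriv z)),
      deriv_fun_mul (hf.deriv z) (hg z), deriv_fun_mul (hf z) (hg.deriv z)]
  rw [wpFn, h2, h1, wpFn, wpFn]
  field_simp
  ring

lemma wpFn_const (c z : ℂ) : wpFn (fun _ => c) z = 0 := by
  simp [wpFn]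

lemma wpFn_prod {ι : Type*} (s : Finset ι) (f : ι → ℂ → ℂ) (hf : ∀ i, Differentiable ℂ (f i))
    {z : ℂ} (hz : ∀ i, f i z ≠ 0) :
    wpFn (fun z => ∏ i ∈ s, f i z) z = ∑ i ∈ s, wpFn (f i) z := by
  classical
  induction s using Finset.induction_on with
  | empty => simp [wpFn_const]
  | insert a s ha ih =>
    simp only [Finset.prod_insert ha, Finset.sum_insert ha]
    rw [wpFn_mul (hf a) (Differentiable.fun_finsetProd fun i _ => hf i) (hz a)
      (Finset.prod_ne_zero_iff.mpr fun i _ => hz i), ih]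

lemma wpFn_primaryFactor {l z : ℂ} (h : z ≠ l) :
    wpFn (primaryFactor l) z = if l = 0 then 0 else 1 / (z - l) ^ 2 - 1 / l ^ 2 := by
  split_ifs with hl
  · subst hl
    have : primaryFactor 0 = fun _ => 1 := funext primaryFactor_zero_left
    rw [this, wpFn_const]
  · have hzl : z - l ≠ 0 := sub_ne_zero.mpr h
    have hne : 1 - z / l ≠ 0 := by
      rw [sub_ne_zero, ne_eq, eq_comm, div_eq_one_iff_eq hl]
      exact h
    have h1 : deriv (fun z : ℂ => 1 - z / l) = fun _ => -(1 / l) := by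
      funext x
      simp
    have h2 : deriv (fun z : ℂ => Complex.exp (z / l + z ^ 2 / (2 * l ^ 2))) =
        fun z => Complex.exp (z / l + z ^ 2 / (2 * l ^ 2)) * (1 / l + z / l ^ 2) := by
      funext x
      have : HasDerivAt (fun z : ℂ => z / l + z ^ 2 / (2 * l ^ 2)) (1 / l + x / l ^ 2) x := by
        have := ((hasDerivAt_id x).div_const l).add
          (((hasDerivAt_id x).pow 2).div_const (2 * l ^ 2))
        refine this.congr_deriv ?_
        simp
        field_simp
      exact this.cexp.deriv
    have h3 : deriv (deriv fun z : ℂ => Complex.exp (z / l + z ^ 2 / (2 * l ^ 2))) z =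
        Complex.exp (z / l + z ^ 2 / (2 * l ^ 2)) * (1 / l + z / l ^ 2) ^ 2 +
          Complex.exp (z / l + z ^ 2 / (2 * l ^ 2)) * (1 / l ^ 2) := by
      rw [h2, deriv_fun_mul (by fun_prop) (by fun_prop), congrFun h2 z]
      simp
      ring
    have hmul : wpFn (primaryFactor l) z = wpFn (fun z => 1 - z / l) z +
        wpFn (fun z => Complex.exp (z / l + z ^ 2 / (2 * l ^ 2))) z :=
      wpFn_mul (by fun_prop) (by fun_prop) hne (Complex.exp_ne_zero _)
    rw [hmul, wpFn, wpFn, h3, h2, h1]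
    have he := Complex.exp_ne_zero (z / l + z ^ 2 / (2 * l ^ 2))
    have hlz : l - z ≠ 0 := sub_ne_zero.mpr h.symm
    simp only [deriv_const]
    generalize Complex.exp (z / l + z ^ 2 / (2 * l ^ 2)) = e at he
    have hs : 1 - z / l = (l - z) / l := by field_simp
    rw [hs, ← neg_sub l z, neg_sq]
    field_simp
    ring

/-- Locally uniform convergence of holomorphic functions passes to the first two derivatives. So
`wpFn` of the product is the limit of `wpFn` of the finite products, which are the partial sums of
the ℘-series without its pole at 0. -/
lemma wpFn_latticeProd {z : ℂ} (hz : z ∉ L.lattice) :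
    wpFn (latticeProd L) z = L.weierstrassPExcept 0 z := by
  have hF := tendstoLocallyUniformlyOn_latticeProd L
  have hd : ∀ s : Finset L.lattice, Differentiable ℂ fun z => ∏ l ∈ s, primaryFactor l z :=
    fun s => Differentiable.fun_finsetProd fun l _ => differentiable_primaryFactor l
  have hF1 := hF.deriv (.of_forall fun s => (hd s).differentiableOn) isOpen_univ
  have hF2 := hF1.deriv (.of_forall fun s => (hd s).deriv.differentiableOn) isOpen_univ
  have ht := (((hF1.tendsto_at (Set.mem_univ z)).pow 2).sub
    ((hF.tendsto_at (Set.mem_univ z)).mul (hF2.tendsto_at (Set.mem_univ z)))).div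
    ((hF.tendsto_at (Set.mem_univ z)).pow 2) (pow_ne_zero 2 (latticeProd_ne_zero L hz))
  refine tendsto_nhds_unique ht ?_
  refine (L.hasSum_weierstrassPExcept 0 z).congr' (.of_forall fun s => ?_)
  have hne : ∀ l : L.lattice, z ≠ l := fun l h => hz (h ▸ l.2)
  refine (Eq.trans ?_ (wpFn_prod s (fun l : L.lattice => primaryFactor l)
    (fun l => differentiable_primaryFactor l)
    (fun l => primaryFactor_ne_zero (hne l))).symm)
  exact Finset.sum_congr rfl fun l _ => (wpFn_primaryFactor (hne l)).symm

/-! ### The sigma function -/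

lemma differentiable_weierstrassSigma : Differentiable ℂ (weierstrassSigma L) :=
  differentiable_id.mul (differentiable_latticeProd L)

lemma weierstrassSigma_zero : weierstrassSigma L 0 = 0 := by simp [weierstrassSigma]

lemma weierstrassSigma_neg (z : ℂ) : weierstrassSigma L (-z) = -weierstrassSigma L z := by
  rw [weierstrassSigma_eq, weierstrassSigma_eq, latticeProd_neg]
  ring

lemma deriv_weierstrassSigma_zero : deriv (weierstrassSigma L) 0 = 1 := by
  have : weierstrassSigma L = fun z => z * latticeProd L z := rfl
  rw [this, deriv_fun_mul differentiableAt_fun_id (differentiable_latticeProd L 0)]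
  simp [latticeProd_zero]

lemma weierstrassSigma_ne_zero {z : ℂ} (hz : z ∉ L.lattice) : weierstrassSigma L z ≠ 0 :=
  mul_ne_zero (fun h => hz (h ▸ zero_mem _)) (latticeProd_ne_zero L hz)

lemma wpFn_weierstrassSigma {z : ℂ} (hz : z ∉ L.lattice) :
    wpFn (weierstrassSigma L) z = L.weierstrassP z := by
  have hz0 : z ≠ 0 := fun h => hz (h ▸ zero_mem _)
  have h1 : wpFn (weierstrassSigma L) z = wpFn (fun z => z) z + wpFn (latticeProd L) z :=
    wpFn_mul differentiable_fun_id (differentiable_latticeProd L) hz0 (latticeProd_ne_zero L hz)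
  have h2 : wpFn (fun z : ℂ => z) z = 1 / z ^ 2 := by simp [wpFn]
  have h3 := L.weierstrassPExcept_add 0 z
  simp only [ZeroMemClass.coe_zero] at h3
  rw [h1, h2, wpFn_latticeProd L hz, ← h3]
  simp [add_comm]

lemma hasDerivAt_zetaFn {f : ℂ → ℂ} (hf : Differentiable ℂ f) {z : ℂ} (hz : f z ≠ 0) :
    HasDerivAt (zetaFn f) (-wpFn f z) z := by
  have := (hf.deriv z).hasDerivAt.div (hf z).hasDerivAt hz
  refine this.congr_deriv ?_
  rw [wpFn]
  ring

/-! ### Quasi-periodicity -/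

lemma countable_lattice : (L.lattice : Set ℂ).Countable :=
  Set.countable_coe_iff.mp L.latticeEquivProd.injective.countable

lemma isPreconnected_compl_lattice : IsPreconnected ((L.lattice : Set ℂ)ᶜ) := by
  exact ((countable_lattice L).isPathConnected_compl_of_one_lt_rank
    (by rw [Complex.rank_real_complex]; norm_num)).isConnected.isPreconnected

lemma dense_compl_lattice : Dense ((L.lattice : Set ℂ)ᶜ) :=
  (countable_lattice L).dense_compl ℝ

/-- The derivative of the difference is ℘(z) - ℘(z + ω) = 0, and the complement of a countable set
in the plane is connected. -/
lemma exists_zetaFn_add {ω : ℂ} (hω : ω ∈ L.lattice) :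
    ∃ η : ℂ, ∀ z ∉ L.lattice,
      zetaFn (weierstrassSigma L) (z + ω) - zetaFn (weierstrassSigma L) z = η := by
  have hmem : ∀ {z : ℂ}, z ∉ L.lattice → z + ω ∉ L.lattice := fun {z} hz h =>
    hz (by simpa using sub_mem h hω)
  have hd : ∀ z ∉ L.lattice, HasDerivAt (fun z => zetaFn (weierstrassSigma L) (z + ω) -
      zetaFn (weierstrassSigma L) z) 0 z := by
    intro z hz
    have h1 := (hasDerivAt_zetaFn (differentiable_weierstrassSigma L)
      (weierstrassSigma_ne_zero L (hmem hz))).comp_add_const z ω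
    have h2 := hasDerivAt_zetaFn (differentiable_weierstrassSigma L)
      (weierstrassSigma_ne_zero L hz)
    refine (h1.sub h2).congr_deriv ?_
    rw [wpFn_weierstrassSigma L hz, wpFn_weierstrassSigma L (hmem hz),
      L.weierstrassP_add_coe z ⟨ω, hω⟩, sub_self]
  exact L.isClosed_lattice.isOpen_compl.exists_is_const_of_deriv_eq_zero
    (isPreconnected_compl_lattice L)
    (fun z hz => (hd z hz).differentiableAt.differentiableWithinAt) (fun z hz => (hd z hz).deriv)

/-- Quasi-periodicity of the sigma function. -/
lemma exists_weierstrassSigma_add {ω : ℂ} (hω : ω ∈ L.lattice) :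
    ∃ C η : ℂ, C ≠ 0 ∧ ∀ z, weierstrassSigma L (z + ω) =
      C * Complex.exp (η * z) * weierstrassSigma L z := by
  obtain ⟨η, hη⟩ := exists_zetaFn_add L hω
  have hmem : ∀ {z : ℂ}, z ∉ L.lattice → z + ω ∉ L.lattice := fun {z} hz h =>
    hz (by simpa using sub_mem h hω)
  have hdiff := differentiable_weierstrassSigma L
  set σ := weierstrassSigma L
  -- The logarithmic derivative of this quotient is ζ(z + ω) - ζ(z) - η = 0. The resulting identity
  -- off the lattice extends to the plane by density.
  have hd : ∀ z ∉ L.lattice,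
      HasDerivAt (fun z => σ (z + ω) / (Complex.exp (η * z) * σ z)) 0 z := by
    intro z hz
    have h1 := (hdiff (z + ω)).hasDerivAt.comp_add_const z ω
    have h2 : HasDerivAt (fun z => Complex.exp (η * z)) (Complex.exp (η * z) * η) z := by
      simpa using ((hasDerivAt_id z).const_mul η).cexp
    have hz0 : σ z ≠ 0 := weierstrassSigma_ne_zero L hz
    have hz1 : σ (z + ω) ≠ 0 := weierstrassSigma_ne_zero L (hmem hz)
    have he := Complex.exp_ne_zero (η * z)
    refine (h1.div (h2.mul (hdiff z).hasDerivAt) (mul_ne_zero he hz0)).congr_deriv ?_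
    have h3 := hη z hz
    simp only [zetaFn] at h3
    have h4 : deriv σ (z + ω) = (η + deriv σ z / σ z) * σ (z + ω) := by
      rw [← h3]; field_simp; ring
    rw [h4]
    field_simp
    simp only [Pi.mul_apply]
    ring
  obtain ⟨C, hC⟩ := L.isClosed_lattice.isOpen_compl.exists_is_const_of_deriv_eq_zero
    (isPreconnected_compl_lattice L)
    (fun z hz => (hd z hz).differentiableAt.differentiableWithinAt) (fun z hz => (hd z hz).deriv)
  have hEq : ∀ z ∉ L.lattice, σ (z + ω) = C * Complex.exp (η * z) * σ z := by
    intro z hz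
    have := hC z hz
    rw [div_eq_iff (mul_ne_zero (Complex.exp_ne_zero _) (weierstrassSigma_ne_zero L hz))] at this
    rw [this]; ring
  refine ⟨C, η, ?_, fun z => ?_⟩
  · rintro rfl
    obtain ⟨z, hz⟩ := (dense_compl_lattice L).nonempty
    exact weierstrassSigma_ne_zero L (hmem hz) (by simpa using hEq z hz)
  · have := Continuous.ext_on (dense_compl_lattice L) (f := fun z => σ (z + ω))
      (g := fun z => C * Complex.exp (η * z) * σ z)
      (hdiff.continuous.comp (by fun_prop)) (by have := hdiff.continuous; fun_prop) hEq
    exact congrFun this z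

end WeierstrassSigma

/-! ### Vanishing of entire functions with elliptic quotients -/

lemma exists_entire_quotient {N g : ℂ → ℂ} (hN : Differentiable ℂ N) (hg : Differentiable ℂ g)
    (h : ∀ z, g z = 0 → N z = 0 ∧ deriv g z ≠ 0) :
    ∃ q : ℂ → ℂ, Differentiable ℂ q ∧ ∀ z, N z = q z * g z := by
  classical
  -- At a zero of g the value is the limit of N/g. Near such a zero the quotient equals the ratio of
  -- the two difference quotients `dslope`, whose denominator is nonzero there because the zero is
  -- simple.
  refine ⟨fun z => if g z = 0 then deriv N z / deriv g z else N z / g z, fun z₀ => ?_,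
    fun z => ?_⟩
  · by_cases hz : g z₀ = 0
    · obtain ⟨hNz, hgz⟩ := h z₀ hz
      have hdN : DifferentiableAt ℂ (dslope N z₀) z₀ :=
        ((Complex.differentiableOn_dslope univ_mem).mpr hN.differentiableOn).differentiableAt
          univ_mem
      have hdg : DifferentiableAt ℂ (dslope g z₀) z₀ :=
        ((Complex.differentiableOn_dslope univ_mem).mpr hg.differentiableOn).differentiableAt
          univ_mem
      refine (hdN.div hdg (by rwa [dslope_same])).congr_of_eventuallyEq ?_
      have hne : ∀ᶠ z in 𝓝[≠] z₀, g z ≠ 0 := by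
        simpa [hz] using (hg z₀).hasDerivAt.eventually_ne (c := 0) hgz
      rw [eventually_nhdsWithin_iff] at hne
      filter_upwards [hne] with z hz'
      rcases eq_or_ne z z₀ with rfl | hzz
      · simp [hz]
      · have := sub_ne_zero.mpr hzz
        simp only [hz' hzz, if_false, Pi.div_apply, dslope_of_ne _ hzz, slope_def_field, hNz, hz,
          sub_zero]
        field_simp
    · refine ((hN z₀).div (hg z₀) hz).congr_of_eventuallyEq ?_
      filter_upwards [hg.continuous.continuousAt.eventually_ne hz] with z hz'
      simp [hz']
  · by_cases hz : g z = 0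
    · simp [hz, (h z hz).1]
    · simp [hz]

lemma dense_ne_zero_of_simple_zeros {g : ℂ → ℂ} (hg : Differentiable ℂ g)
    (h : ∀ z, g z = 0 → deriv g z ≠ 0) : Dense {z | g z ≠ 0} := by
  intro z
  by_cases hz : g z = 0
  · have hne : ∀ᶠ w in 𝓝[≠] z, g w ≠ 0 := by
      simpa [hz] using (hg z).hasDerivAt.eventually_ne (c := 0) (h z hz)
    exact mem_closure_iff_frequently.mpr
      (hne.frequently.filter_mono nhdsWithin_le_nhds)
  · exact subset_closure hz

/-- N/g extends to an entire function. It is periodic because N and g acquire the same multiplier,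
hence bounded, hence constant by Liouville; its value at a is 0. -/
lemma eq_zero_of_elliptic_quotient (L : PeriodPair) {N g : ℂ → ℂ} (hN : Differentiable ℂ N)
    (hg : Differentiable ℂ g) (h : ∀ z, g z = 0 → N z = 0 ∧ deriv g z ≠ 0)
    (hper : ∀ ω ∈ L.lattice, ∀ z, ∃ M : ℂ, M ≠ 0 ∧ N (z + ω) = M * N z ∧ g (z + ω) = M * g z)
    {a : ℂ} (hNa : N a = 0) (hga : g a ≠ 0) (z : ℂ) : N z = 0 := by
  obtain ⟨q, hq, hNq⟩ := exists_entire_quotient hN hg h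
  have hqper : ∀ ω ∈ L.lattice, ∀ z, q (z + ω) = q z := by
    intro ω hω
    refine congrFun (Continuous.ext_on (dense_ne_zero_of_simple_zeros hg fun z hz => (h z hz).2)
      (hq.continuous.comp (by fun_prop)) hq.continuous fun z hz => ?_)
    obtain ⟨M, hM, h1, h2⟩ := hper ω hω z
    have hz : g z ≠ 0 := hz
    rw [hNq, hNq z, h2] at h1
    have : M * g z ≠ 0 := mul_ne_zero hM hz
    apply mul_right_cancel₀ this
    linear_combination h1
  have hconst : ∀ z, q z = q a := fun z => hq.apply_eq_apply_of_bounded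
    (IsZLattice.isCompact_range_of_periodic L.lattice _ hq.continuous
      fun z w hw => hqper w hw z).isBounded z a
  have hqa : q a = 0 := by
    have := hNq a
    rw [hNa, eq_comm, mul_eq_zero] at this
    exact this.resolve_right hga
  rw [hNq, hconst, hqa, zero_mul]

/-! ### Functions with the addition theorem of the sigma function -/

/-- The four-variable addition expression; it vanishes identically for the admissible `[u]`. -/
noncomputable def additionDefect (f : ℂ → ℂ) (a b c d : ℂ) : ℂ :=
  (deriv f a * f b + f a * deriv f b) * (f c * f d) -
    f a * f b * (deriv f c * f d + f c * deriv f d) - f (a + b) * f (a - c) * f (c - b)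

/-- The properties of the admissible functions `[u]` on which all identities rest. -/
structure SigmaLike (f : ℂ → ℂ) : Prop where
  differentiable : Differentiable ℂ f
  neg : ∀ z, f (-z) = -f z
  deriv_zero : deriv f 0 = 1
  addition : ∀ a b c d, a + b = c + d → additionDefect f a b c d = 0

/-! ### The addition theorem in the three cases -/

lemma eventually_comp_affine_ne_zero {f : ℂ → ℂ} (hf : Differentiable ℂ f)
    (hd : deriv f 0 = 1) (a : ℂ) {k : ℂ} (hk : k ≠ 0) :
    ∀ᶠ t in 𝓝[≠] (0 : ℂ), f (a + k * t) ≠ 0 := by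
  have hd' : Differentiable ℂ fun t => f (a + k * t) := hf.comp (by fun_prop)
  refine (hd'.analyticAt 0).eventually_eq_zero_or_eventually_ne_zero.resolve_left fun h => ?_
  have h0 : (fun t => f (a + k * t)) = fun _ => 0 :=
    AnalyticOnNhd.eq_of_eventuallyEq (fun z _ => hd'.analyticAt z) (fun z _ => analyticAt_const) h
  have h1 : f = fun _ => 0 := funext fun z => by
    have := congrFun h0 ((z - a) / k)
    simpa [mul_div_cancel₀ _ hk] using this
  rw [h1] at hd
  simp at hd

/-- As a function of c, the defect is compared with σ(c)σ(a + b - c). The condition σ(a + b) ≠ 0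
keeps the zeros of this product simple; the conditions on a and b make it nonzero at the base point
c = a, where the defect vanishes. -/
lemma weierstrassSigma_addition_of_ne (L : PeriodPair) {a b : ℂ}
    (ha : weierstrassSigma L a ≠ 0) (hb : weierstrassSigma L b ≠ 0)
    (hs : weierstrassSigma L (a + b) ≠ 0) (c : ℂ) :
    additionDefect (weierstrassSigma L) a b c (a + b - c) = 0 := by
  have hd := differentiable_weierstrassSigma L
  have hneg := weierstrassSigma_neg L
  have h0 := weierstrassSigma_zero L
  have hd0 := deriv_weierstrassSigma_zero L
  have hnz : ∀ z, weierstrassSigma L z = 0 → z ∈ L.lattice := fun z hz => by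
    by_contra h
    exact weierstrassSigma_ne_zero L h hz
  have hqp : ∀ ω ∈ L.lattice, ∃ C η : ℂ, C ≠ 0 ∧
      (∀ z, weierstrassSigma L (z + ω) = C * Complex.exp (η * z) * weierstrassSigma L z) ∧
      ∀ z, deriv (weierstrassSigma L) (z + ω) = C * Complex.exp (η * z) *
        (deriv (weierstrassSigma L) z + η * weierstrassSigma L z) := by
    intro ω hω
    obtain ⟨C, η, hC, h⟩ := exists_weierstrassSigma_add L hω
    refine ⟨C, η, hC, h, fun z => ?_⟩
    have h1 := (hd (z + ω)).hasDerivAt.comp_add_const z ω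
    have h2 : HasDerivAt (fun z => Complex.exp (η * z)) (Complex.exp (η * z) * η) z := by
      simpa using ((hasDerivAt_id z).const_mul η).cexp
    have h3 := ((h2.const_mul C).mul (hd z).hasDerivAt)
    have h4 := h1.congr_of_eventuallyEq (f₁ := fun z => C * Complex.exp (η * z) *
      weierstrassSigma L z) (Eventually.of_forall fun z => (h z).symm)
    rw [h4.unique h3]
    ring
  set σ := weierstrassSigma L
  have hsub : ∀ C η ω : ℂ, C ≠ 0 → (∀ z, σ (z + ω) = C * Complex.exp (η * z) * σ z) →
      ∀ z, σ (z - ω) = C⁻¹ * (Complex.exp (η * (z - ω)))⁻¹ * σ z := by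
    intro C η ω hC h z
    have := h (z - ω)
    rw [sub_add_cancel] at this
    rw [this]
    have := Complex.exp_ne_zero (η * (z - ω))
    field_simp
  -- The multiplier is the same for both functions: the terms in η produced by σ'(c) and σ'(a + b -
  -- c) cancel.
  have hN : ∀ ω ∈ L.lattice, ∀ z, ∃ M : ℂ, M ≠ 0 ∧
      additionDefect σ a b (z + ω) (a + b - (z + ω)) = M * additionDefect σ a b z (a + b - z) ∧
      σ (z + ω) * σ (a + b - (z + ω)) = M * (σ z * σ (a + b - z)) := by
    intro ω hω z
    obtain ⟨C, η, hC, h1, h2⟩ := hqp ω hω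
    have h3 := hsub C η ω hC h1
    have h4 : deriv σ (a + b - z - ω) = C⁻¹ * (Complex.exp (η * (a + b - z - ω)))⁻¹ *
        (deriv σ (a + b - z) - η * σ (a + b - z)) := by
      have h5 := h2 (a + b - z - ω)
      rw [sub_add_cancel, h3] at h5
      rw [h5]
      have := Complex.exp_ne_zero (η * (a + b - z - ω))
      field_simp
      ring
    refine ⟨Complex.exp (η * z) * (Complex.exp (η * (a + b - z - ω)))⁻¹,
      mul_ne_zero (Complex.exp_ne_zero _) (inv_ne_zero (Complex.exp_ne_zero _)), ?_, ?_⟩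
    · have e1 : a + b - (z + ω) = a + b - z - ω := by ring
      have e2 : a - (z + ω) = a - z - ω := by ring
      have e3 : z + ω - b = z - b + ω := by ring
      have e4 : Complex.exp (η * (z - b)) * (Complex.exp (η * (a - z - ω)))⁻¹ =
          Complex.exp (η * z) * (Complex.exp (η * (a + b - z - ω)))⁻¹ := by
        rw [← Complex.exp_neg, ← Complex.exp_neg, ← Complex.exp_add, ← Complex.exp_add]
        congr 1
        ring
      have e5 : σ (a - z - ω) * σ (z - b + ω) = Complex.exp (η * z) *
          (Complex.exp (η * (a + b - z - ω)))⁻¹ * (σ (a - z) * σ (z - b)) := by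
        rw [h3, h1, ← e4]
        field_simp
      simp only [additionDefect]
      rw [e1, e2, e3, mul_assoc (σ (a + b)), e5, h4, h3 (a + b - z), h1 z, h2 z]
      field_simp
      ring
    · have e1 : a + b - (z + ω) = a + b - z - ω := by ring
      rw [e1, h3, h1]
      field_simp
  have hddef : Differentiable ℂ fun z => additionDefect σ a b z (a + b - z) := by
    have hd1 := hd.deriv
    have := hd.comp (f := fun z => a + b - z) (by fun_prop)
    have := hd.comp (f := fun z => a - z) (by fun_prop)
    have := hd.comp (f := fun z => z - b) (by fun_prop)
    have := hd1.comp (f := fun z => a + b - z) (by fun_prop)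
    simp only [Function.comp_def] at *
    unfold additionDefect
    fun_prop
  have hdcomp := hd.comp (f := fun z => a + b - z) (by fun_prop)
  simp only [Function.comp_def] at hdcomp
  have hdg : ∀ z, deriv (fun z => σ z * σ (a + b - z)) z =
      deriv σ z * σ (a + b - z) - σ z * deriv σ (a + b - z) := by
    intro z
    have h1 : HasDerivAt (fun z => σ (a + b - z)) (-deriv σ (a + b - z)) z := by
      simpa using (hd (a + b - z)).hasDerivAt.comp_const_sub (a + b) z
    rw [((hd z).hasDerivAt.fun_mul h1).deriv]
    ring
  have hshift : ∀ ω ∈ L.lattice, ∀ z, σ z ≠ 0 → σ (z + ω) ≠ 0 := by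
    intro ω hω z hz
    obtain ⟨C, η, hC, h1, -⟩ := hqp ω hω
    rw [h1]
    exact mul_ne_zero (mul_ne_zero hC (Complex.exp_ne_zero _)) hz
  have hderiv : ∀ ω ∈ L.lattice, deriv σ ω ≠ 0 := by
    intro ω hω
    obtain ⟨C, η, hC, -, h2⟩ := hqp ω hω
    have := h2 0
    rw [zero_add, hd0, h0] at this
    simpa [this] using hC
  refine eq_zero_of_elliptic_quotient L (N := fun z => additionDefect σ a b z (a + b - z))
    (g := fun z => σ z * σ (a + b - z)) hddef (hd.mul hdcomp) ?_ hN (a := a) ?_ ?_ c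
  · intro z hz
    rw [hdg]
    rcases mul_eq_zero.mp hz with h | h
    · have hzl := hnz z h
      constructor
      -- A lattice shift moves the zero to c = 0, where the defect cancels since σ is odd with σ'(0)
      -- = 1. The zeros of the other factor are moved to c = a + b in the same way.
      · obtain ⟨M, -, h1, -⟩ := hN z hzl 0
        rw [zero_add] at h1
        simp only [h1]
        simp only [additionDefect, h0, hd0, sub_zero, zero_sub, hneg]
        ring
      · rw [h, zero_mul, sub_zero, sub_eq_add_neg]
        exact mul_ne_zero (hderiv z hzl) (hshift _ (neg_mem hzl) _ hs)
    · have hzl := hnz _ h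
      have hzl' : z - (a + b) ∈ L.lattice := by simpa using neg_mem hzl
      constructor
      · obtain ⟨M, -, h1, -⟩ := hN _ hzl' (a + b)
        rw [add_sub_cancel] at h1
        simp only [h1]
        simp only [additionDefect, sub_self, h0, hd0, sub_add_cancel_left, hneg, add_sub_cancel_right]
        ring
      · rw [h, mul_zero, zero_sub]
        have := hshift _ hzl' _ hs
        rw [add_sub_cancel] at this
        exact neg_ne_zero.mpr (mul_ne_zero this (hderiv _ hzl))
  · simp only [additionDefect, add_sub_cancel_left, sub_self, h0]
    ring
  · simpa using ⟨ha, hb⟩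

lemma sigmaLike_weierstrassSigma (L : PeriodPair) : SigmaLike (weierstrassSigma L) where
  differentiable := differentiable_weierstrassSigma L
  neg := weierstrassSigma_neg L
  deriv_zero := deriv_weierstrassSigma_zero L
  addition := by
    intro a b c d hs
    have hd := differentiable_weierstrassSigma L
    have hc := hd.continuous
    have hc' := hd.deriv.continuous
    -- The nonvanishing conditions hold after moving a and b by a small t ≠ 0; continuity at t = 0
    -- removes them.
    have hcont : Continuous fun t : ℂ => additionDefect (weierstrassSigma L) (a + 1 * t) (b + 1 * t)
        c (a + b + 2 * t - c) := by
      unfold additionDefect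
      fun_prop
    have hne := fun (a k : ℂ) (hk : k ≠ 0) =>
      eventually_comp_affine_ne_zero hd (deriv_weierstrassSigma_zero L) a hk
    have h0 : Tendsto (fun t : ℂ => additionDefect (weierstrassSigma L) (a + 1 * t) (b + 1 * t)
        c (a + b + 2 * t - c)) (𝓝[≠] 0) (𝓝 0) := by
      refine tendsto_const_nhds.congr' ?_
      filter_upwards [hne a 1 one_ne_zero, hne b 1 one_ne_zero, hne (a + b) 2 two_ne_zero]
        with t h1 h2 h3
      have e : a + 1 * t + (b + 1 * t) = a + b + 2 * t := by ring
      have := weierstrassSigma_addition_of_ne L h1 h2 (by rwa [e]) c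
      rw [e] at this
      exact this.symm
    have h1 := tendsto_nhds_unique h0 ((hcont.tendsto 0).mono_left nhdsWithin_le_nhds)
    have e : d = a + b + 2 * 0 - c := by linear_combination -hs
    rw [e]
    simpa using h1.symm

lemma sigmaLike_sinh : SigmaLike Complex.sinh where
  differentiable := Complex.differentiable_sinh
  neg := Complex.sinh_neg
  deriv_zero := by simp
  addition := by
    intro a b c d hs
    obtain rfl : d = a + b - c := by linear_combination -hs
    simp only [additionDefect, Complex.deriv_sinh, Complex.sinh, Complex.cosh, neg_sub, neg_add_rev,
      Complex.exp_add, Complex.exp_sub, Complex.exp_neg]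
    have ha := Complex.exp_ne_zero a
    have hb := Complex.exp_ne_zero b
    have hc := Complex.exp_ne_zero c
    field_simp
    ring

lemma sigmaLike_id : SigmaLike fun u => u where
  differentiable := differentiable_fun_id
  neg := fun _ => rfl
  deriv_zero := by simp
  addition := by
    intro a b c d hs
    obtain rfl : d = a + b - c := by linear_combination -hs
    simp [additionDefect]
    ring

lemma IsBracket.sigmaLike {f : ℂ → ℂ} (hf : IsBracket f) : SigmaLike f := by
  rcases hf with ⟨L, rfl⟩ | rfl | rfl
  · exact sigmaLike_weierstrassSigma L
  · exact sigmaLike_sinh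
  · exact sigmaLike_id

/-! ### Consequences of the addition theorem -/

namespace SigmaLike

variable {f : ℂ → ℂ} (hf : SigmaLike f)
include hf

lemma map_zero : f 0 = 0 := by
  have := hf.neg 0
  rw [neg_zero] at this
  linear_combination this / 2

lemma map_sub_comm (a b : ℂ) : f (a - b) = -f (b - a) := by
  rw [← hf.neg, neg_sub]

lemma deriv_neg (z : ℂ) : deriv f (-z) = deriv f z := by
  have h1 : deriv (fun z => f (-z)) z = -deriv f (-z) := deriv_comp_neg f z
  have h2 : (fun z => f (-z)) = fun z => -f z := funext hf.neg
  rw [h2, deriv.fun_neg] at h1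
  linear_combination h1

lemma zetaFn_neg (z : ℂ) : zetaFn f (-z) = -zetaFn f z := by
  rw [zetaFn, zetaFn, hf.deriv_neg, hf.neg, div_neg]

lemma eventually_ne (a : ℂ) {k : ℂ} (hk : k ≠ 0) : ∀ᶠ t in 𝓝[≠] (0 : ℂ), f (a + k * t) ≠ 0 :=
  eventually_comp_affine_ne_zero hf.differentiable hf.deriv_zero a hk

lemma zetaFn_add_sub_add {a b c d : ℂ} (hs : a + b = c + d) (ha : f a ≠ 0) (hb : f b ≠ 0)
    (hc : f c ≠ 0) (hd : f d ≠ 0) :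
    zetaFn f a + zetaFn f b - zetaFn f c - zetaFn f d =
      f (a + b) * f (a - c) * f (c - b) / (f a * f b * f c * f d) := by
  have h := hf.addition a b c d hs
  rw [additionDefect] at h
  simp only [zetaFn]
  field_simp
  linear_combination h

/-- The three-term relation. -/
lemma three_term {a b c d e g : ℂ} (h₁ : a + b = c + d) (h₂ : a + b = e + g) :
    f (a - c) * f (c - b) * (f e * f g) + f (c - e) * f (e - d) * (f a * f b) +
      f (e - a) * f (a - g) * (f c * f d) = 0 := by
  have hcont := hf.differentiable.continuous
  have hc : Continuous fun t : ℂ =>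
      f (a - c) * f (c - b) * (f (e + 1 * t) * f (g + 1 * t)) +
        f (c - e) * f (e - d) * (f (a + 1 * t) * f (b + 1 * t)) +
          f (e - a) * f (a - g) * (f (c + 1 * t) * f (d + 1 * t)) := by
    fun_prop
  -- For three pairs with a common sum, the ζ-identities for consecutive pairs add up cyclically to
  -- 0. A common translation by t leaves all differences unchanged and makes every denominator, as
  -- well as the common factor f(a + b + 2t), nonzero.
  have h0 : Tendsto (fun t : ℂ =>
      f (a - c) * f (c - b) * (f (e + 1 * t) * f (g + 1 * t)) +
        f (c - e) * f (e - d) * (f (a + 1 * t) * f (b + 1 * t)) +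
          f (e - a) * f (a - g) * (f (c + 1 * t) * f (d + 1 * t))) (𝓝[≠] 0) (𝓝 0) := by
    refine tendsto_const_nhds.congr' ?_
    have hne := fun z => hf.eventually_ne z one_ne_zero
    filter_upwards [hne a, hne b, hne c, hne d, hne e, hne g,
      hf.eventually_ne (a + b) two_ne_zero] with t ha hb hc hd he hg hs
    have k1 := hf.zetaFn_add_sub_add (a := a + 1 * t) (b := b + 1 * t) (c := c + 1 * t)
      (d := d + 1 * t) (by linear_combination h₁) ha hb hc hd
    have k2 := hf.zetaFn_add_sub_add (a := c + 1 * t) (b := d + 1 * t) (c := e + 1 * t)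
      (d := g + 1 * t) (by linear_combination h₂ - h₁) hc hd he hg
    have k3 := hf.zetaFn_add_sub_add (a := e + 1 * t) (b := g + 1 * t) (c := a + 1 * t)
      (d := b + 1 * t) (by linear_combination -h₂) he hg ha hb
    have s1 : a + 1 * t + (b + 1 * t) = a + b + 2 * t := by ring
    have s2 : c + 1 * t + (d + 1 * t) = a + b + 2 * t := by linear_combination -h₁
    have s3 : e + 1 * t + (g + 1 * t) = a + b + 2 * t := by linear_combination -h₂
    rw [s1, add_sub_add_right_eq_sub, add_sub_add_right_eq_sub] at k1
    rw [s2, add_sub_add_right_eq_sub, add_sub_add_right_eq_sub] at k2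
    rw [s3, add_sub_add_right_eq_sub, add_sub_add_right_eq_sub] at k3
    have hsum := congrArg₂ (· + ·) (congrArg₂ (· + ·) k1 k2) k3
    have hzero : (0 : ℂ) = f (a + b + 2 * t) * f (a - c) * f (c - b) /
          (f (a + 1 * t) * f (b + 1 * t) * f (c + 1 * t) * f (d + 1 * t)) +
        f (a + b + 2 * t) * f (c - e) * f (e - d) /
          (f (c + 1 * t) * f (d + 1 * t) * f (e + 1 * t) * f (g + 1 * t)) +
        f (a + b + 2 * t) * f (e - a) * f (a - g) /
          (f (e + 1 * t) * f (g + 1 * t) * f (a + 1 * t) * f (b + 1 * t)) := by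
      rw [← hsum]; ring
    clear k1 k2 k3 hsum
    generalize f (a + 1 * t) = fa at *
    generalize f (b + 1 * t) = fb at *
    generalize f (c + 1 * t) = fc at *
    generalize f (d + 1 * t) = fd at *
    generalize f (e + 1 * t) = fe at *
    generalize f (g + 1 * t) = fg at *
    generalize f (a + b + 2 * t) = fs at *
    apply mul_left_cancel₀ hs
    field_simp at hzero
    linear_combination hzero
  have h1 := tendsto_nhds_unique h0 ((hc.tendsto 0).mono_left nhdsWithin_le_nhds)
  simpa using h1.symm

/-- This is the derivative of the addition identity in c at c = a, with d = a + b - c. -/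
lemma wpFn_sub_wpFn {u v : ℂ} (hu : f u ≠ 0) (hv : f v ≠ 0) :
    wpFn f u - wpFn f v = -(f (u + v) * f (u - v)) / (f u ^ 2 * f v ^ 2) := by
  have hd := hf.differentiable
  have hD : HasDerivAt (fun c => additionDefect f u v c (u + v - c))
      (((deriv f u * f v + f u * deriv f v) * (deriv f u * f v + f u * -deriv f v)) -
        f u * f v * ((deriv (deriv f) u * f v + deriv f u * -deriv f v) +
          (deriv f u * deriv f v + f u * -deriv (deriv f) v)) -
        (f (u + v) * -deriv f 0 * f (u - v) + f (u + v) * f 0 * deriv f (u - v))) u := by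
    have h1 : HasDerivAt (fun c => f (u + v - c)) (-deriv f v) u := by
      simpa using (hd (u + v - u)).hasDerivAt.comp_const_sub (u + v) u
    have h2 : HasDerivAt (fun c => deriv f (u + v - c)) (-deriv (deriv f) v) u := by
      simpa using (hd.deriv (u + v - u)).hasDerivAt.comp_const_sub (u + v) u
    have h3 : HasDerivAt (fun c => f (u - c)) (-deriv f 0) u := by
      simpa using (hd (u - u)).hasDerivAt.comp_const_sub u u
    have h4 : HasDerivAt (fun c => f (c - v)) (deriv f (u - v)) u :=
      (hd (u - v)).hasDerivAt.comp_sub_const u v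
    have h5 := (hd u).hasDerivAt
    have h6 := (hd.deriv u).hasDerivAt
    have e1 := (h5.fun_mul h1).const_mul (deriv f u * f v + f u * deriv f v)
    have e2 := ((h6.fun_mul h1).fun_add (h5.fun_mul h2)).const_mul (f u * f v)
    have e3 := (h3.const_mul (f (u + v))).fun_mul h4
    refine ((e1.fun_sub e2).fun_sub e3).congr_deriv ?_
    simp only [add_sub_cancel_left, sub_self]
  have h0 : (fun c => additionDefect f u v c (u + v - c)) = fun _ => 0 :=
    funext fun c => hf.addition _ _ _ _ (by ring)
  rw [h0] at hD
  have := hD.unique (hasDerivAt_const u (0 : ℂ))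
  rw [hf.deriv_zero, hf.map_zero] at this
  simp only [wpFn]
  field_simp
  linear_combination this

/-- Logarithmic differentiation of `wpFn_sub_wpFn` in u. -/
lemma deriv_wpFn {u v : ℂ} (hu : f u ≠ 0) (hv : f v ≠ 0) (ha : f (u + v) ≠ 0)
    (hs : f (u - v) ≠ 0) :
    deriv (wpFn f) u =
      (wpFn f u - wpFn f v) * (zetaFn f (u + v) + zetaFn f (u - v) - 2 * zetaFn f u) := by
  have hd := hf.differentiable
  have hev : wpFn f =ᶠ[𝓝 u]
      fun x => wpFn f v + -(f (x + v) * f (x - v)) / (f x ^ 2 * f v ^ 2) := by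
    filter_upwards [hd.continuous.continuousAt.eventually_ne hu] with x hx
    rw [← hf.wpFn_sub_wpFn hx hv]
    ring
  have h1 : HasDerivAt (fun c => f (c + v)) (deriv f (u + v)) u :=
    (hd (u + v)).hasDerivAt.comp_add_const u v
  have h2 : HasDerivAt (fun c => f (c - v)) (deriv f (u - v)) u :=
    (hd (u - v)).hasDerivAt.comp_sub_const u v
  have h3 := ((h1.fun_mul h2).fun_neg.fun_div
    (((hd u).hasDerivAt.fun_pow 2).mul_const (f v ^ 2)) (by positivity)).const_add (wpFn f v)
  rw [hev.deriv_eq, h3.deriv, hf.wpFn_sub_wpFn hu hv]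
  simp only [zetaFn]
  field_simp
  push_cast
  ring

/-- With a = u - k₃ and b = h - k₃ - u, subtracting the formulas for ℘'(a) and ℘'(b) cancels ζ(a -
b) and leaves 2(℘(a) - ℘(b))(ζ(a + b) - ζ(a) - ζ(b)). The hypothesis ℘(a) ≠ ℘(b) already forces f(a
+ b) and f(a - b) to be nonzero. -/
lemma hathatF_eq {k₃ u h : ℂ} (hu : f (u - k₃) ≠ 0) (hv : f (h - k₃ - u) ≠ 0)
    (hne : wpFn f (u - k₃) ≠ wpFn f (h - k₃ - u)) :
    hathatF f k₃ u h = 1 / 2 * ((deriv (wpFn f) (u - k₃) - deriv (wpFn f) (h - k₃ - u)) /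
      (wpFn f (u - k₃) - wpFn f (h - k₃ - u))) := by
  have hs : h - 2 * k₃ = u - k₃ + (h - k₃ - u) := by ring
  rw [hathatF, hs]
  generalize u - k₃ = a at *
  generalize h - k₃ - u = b at *
  have hne' := sub_ne_zero.mpr hne
  have hprod := hne'
  rw [hf.wpFn_sub_wpFn hu hv] at hprod
  have ha : f (a + b) ≠ 0 := fun h0 => hprod (by simp [h0])
  have hb : f (a - b) ≠ 0 := fun h0 => hprod (by simp [h0])
  have hb' : f (b - a) ≠ 0 := by rwa [hf.map_sub_comm, neg_ne_zero]
  have h1 := hf.deriv_wpFn hu hv ha hb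
  have h2 := hf.deriv_wpFn hv hu (by rwa [add_comm]) hb'
  have h3 : zetaFn f (b - a) = -zetaFn f (a - b) := by rw [← hf.zetaFn_neg, neg_sub]
  rw [h1, h2, h3, add_comm b a]
  field_simp
  ring

/-! ### The degenerations of `F` -/

omit hf in
lemma _root_.TripletPair.isBigO_sub_taylor_one {φ : ℂ → ℂ} {a c : ℂ} {U : Set ℂ} (hU : U ∈ 𝓝 a)
    (hφ : DifferentiableOn ℂ φ U) (hc : HasDerivAt φ c a) :
    (fun z => φ z - (φ a + (z - a) * c)) =O[𝓝 a] fun z => (z - a) ^ 2 := by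
  have h1 : DifferentiableAt ℂ (dslope φ a) a :=
    ((Complex.differentiableOn_dslope hU).mpr hφ).differentiableAt hU
  have h2 := (isBigO_refl (fun z => z - a) (𝓝 a)).mul h1.isBigO_sub
  refine h2.congr (fun z => ?_) fun z => by ring
  have := sub_smul_dslope φ a z
  rw [smul_eq_mul] at this
  rw [mul_sub, this, dslope_same, hc.deriv]
  ring

/-- First-order Taylor expansion in k₂ at k₁, where F = 1, so that its derivative is its logarithmic
derivative F̂. -/
lemma bigF_isBigO {k₁ k₃ u h : ℂ} (h1 : f (k₃ - k₁) ≠ 0) (h2 : f (h - k₁ - k₃) ≠ 0)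
    (h3 : f (u - k₁) ≠ 0) (h4 : f (h - k₁ - u) ≠ 0) :
    (fun k₂ : ℂ => bigF f k₁ k₂ k₃ u h - (1 + (k₂ - k₁) * hatF f k₁ k₃ u h))
      =O[𝓝 k₁] fun k₂ : ℂ => (k₂ - k₁) ^ 2 := by
  have hd := hf.differentiable
  have hc := hd.continuous
  have hcomp : ∀ a x : ℂ, HasDerivAt (fun k => f (a - k)) (-deriv f (a - x)) x := fun a x =>
    (hd (a - x)).hasDerivAt.comp_const_sub a x
  have hcomp' : ∀ a b x : ℂ, HasDerivAt (fun k => f (a - k - b)) (-deriv f (a - x - b)) x := by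
    intro a b x
    have := hcomp (a - b) x
    simpa only [sub_right_comm] using this
  have hone : bigF f k₁ k₁ k₃ u h = 1 := by
    rw [bigF]
    field_simp
  have hden : ∀ k, f (k₃ - k) ≠ 0 → f (h - k - k₃) ≠ 0 →
      f (u - k₁) * f (h - k₁ - u) * f (k₃ - k) * f (h - k - k₃) ≠ 0 := fun k ha hb =>
    mul_ne_zero (mul_ne_zero (mul_ne_zero h3 h4) ha) hb
  have hderiv := fun k (ha : f (k₃ - k) ≠ 0) (hb : f (h - k - k₃) ≠ 0) =>
    (((((hcomp u k).fun_mul (hcomp' h u k)).mul_const (f (k₃ - k₁))).mul_const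
      (f (h - k₁ - k₃))).fun_div (((hcomp k₃ k).const_mul (f (u - k₁) * f (h - k₁ - u))).fun_mul
        (hcomp' h k₃ k)) (hden k ha hb))
  have hU : {k | f (k₃ - k) ≠ 0 ∧ f (h - k - k₃) ≠ 0} ∈ 𝓝 k₁ :=
    (((hcomp k₃ k₁).continuousAt.eventually_ne h1).and
      ((hcomp' h k₃ k₁).continuousAt.eventually_ne h2))
  have key := isBigO_sub_taylor_one (φ := fun k₂ => bigF f k₁ k₂ k₃ u h)
    (c := hatF f k₁ k₃ u h) hU
    (fun k hk => (hderiv k hk.1 hk.2).differentiableAt.differentiableWithinAt)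
    ((hderiv k₁ h1 h2).congr_deriv (by
      rw [hatF]
      simp only [zetaFn]
      field_simp
      ring))
  simpa only [hone] using key

/-- Write f(z) = z g(z) with g even and g(0) = 1. Then ζ(z) - 1/z = g'(z)/g(z), which vanishes at 0
because g' is odd. -/
lemma zetaFn_sub_inv_isBigO :
    (fun z => zetaFn f z - 1 / z) =O[𝓝[≠] 0] fun z => z := by
  have hd : Differentiable ℂ (dslope f 0) := by
    rw [← differentiableOn_univ]
    exact (Complex.differentiableOn_dslope univ_mem).mpr hf.differentiable.differentiableOn
  have h0 : dslope f 0 0 = 1 := by rw [dslope_same, hf.deriv_zero]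
  have hmul : ∀ z, f z = z * dslope f 0 z := fun z => by
    simpa [hf.map_zero, eq_comm] using sub_smul_dslope f 0 z
  have heven : ∀ z, dslope f 0 (-z) = dslope f 0 z := by
    intro z
    rcases eq_or_ne z 0 with rfl | hz
    · simp
    · have := hf.neg z
      rw [hmul, hmul z] at this
      apply mul_left_cancel₀ hz
      linear_combination -this
  have hd0 : deriv (dslope f 0) 0 = 0 := by
    have h1 := deriv_comp_neg (dslope f 0) 0
    simp only [heven, neg_zero] at h1
    linear_combination h1 / 2
  have hz : DifferentiableAt ℂ (zetaFn (dslope f 0)) 0 :=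
    (hasDerivAt_zetaFn hd (by rw [h0]; exact one_ne_zero)).differentiableAt
  have hO := hz.isBigO_sub
  simp only [sub_zero] at hO
  refine (hO.mono nhdsWithin_le_nhds).congr' ?_ EventuallyEq.rfl
  have hne : ∀ᶠ z in 𝓝[≠] (0 : ℂ), dslope f 0 z ≠ 0 :=
    nhdsWithin_le_nhds (hd.continuous.continuousAt.eventually_ne (by rw [h0]; exact one_ne_zero))
  filter_upwards [hne, self_mem_nhdsWithin] with z hz hz0
  have hz0 : z ≠ 0 := hz0
  have h1 : deriv f z = dslope f 0 z + z * deriv (dslope f 0) z := by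
    have : f = fun z => z * dslope f 0 z := funext hmul
    conv_lhs => rw [this]
    rw [deriv_fun_mul differentiableAt_fun_id (hd z)]
    simp
  simp only [zetaFn, hd0, zero_div, sub_zero]
  rw [h1, hmul z]
  field_simp
  ring

lemma hatF_isBigO {k₃ u h : ℂ} (h1 : f (h - 2 * k₃) ≠ 0) (h2 : f (u - k₃) ≠ 0)
    (h3 : f (h - k₃ - u) ≠ 0) :
    (fun k₁ : ℂ => hatF f k₁ k₃ u h - (1 / (k₃ - k₁) + hathatF f k₃ u h))
      =O[𝓝[≠] k₃] fun k₁ : ℂ => k₃ - k₁ := by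
  have hd := hf.differentiable
  have hz : ∀ a x, f (a - x) ≠ 0 → DifferentiableAt ℂ (fun k => zetaFn f (a - k)) x :=
    fun a x hx => ((hasDerivAt_zetaFn hd hx).comp_const_sub a x).differentiableAt
  have e1 : h - 2 * k₃ = h - k₃ - k₃ := by ring
  have e2 : h - k₃ - u = h - u - k₃ := by ring
  have hg : DifferentiableAt ℂ (fun k => zetaFn f (h - k₃ - k) - zetaFn f (u - k) -
      zetaFn f (h - u - k)) k₃ :=
    ((hz _ _ (by rwa [← e1])).fun_sub (hz _ _ h2)).fun_sub (hz _ _ (by rwa [← e2]))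
  have hO1 : (fun k => (zetaFn f (h - k₃ - k) - zetaFn f (u - k) - zetaFn f (h - u - k)) -
      (zetaFn f (h - k₃ - k₃) - zetaFn f (u - k₃) - zetaFn f (h - u - k₃)))
        =O[𝓝[≠] k₃] fun k => k₃ - k := by
    refine (hg.isBigO_sub.mono nhdsWithin_le_nhds).trans ?_
    exact IsBigO.of_bound 1 (Eventually.of_forall fun k => by rw [norm_sub_rev, one_mul])
  have ht : Tendsto (fun k => k₃ - k) (𝓝[≠] k₃) (𝓝[≠] 0) := by
    refine tendsto_nhdsWithin_iff.mpr ⟨?_, ?_⟩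
    · have : Tendsto (fun k => k₃ - k) (𝓝 k₃) (𝓝 (k₃ - k₃)) :=
        (continuous_const.sub continuous_id).tendsto _
      rw [sub_self] at this
      exact this.mono_left nhdsWithin_le_nhds
    · filter_upwards [self_mem_nhdsWithin] with k hk
      exact sub_ne_zero.mpr (Ne.symm hk)
  have hO2 := hf.zetaFn_sub_inv_isBigO.comp_tendsto ht
  refine (hO2.add hO1).congr_left fun k => ?_
  simp only [Function.comp, hatF, hathatF, e1, e2]
  rw [sub_right_comm h k k₃, sub_right_comm h k u]
  ring

end SigmaLike

/-! ### Unique solvability of the triplet-pair systems -/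

/-- The system is linear in the two unknowns, with the stated determinant up to sign. When it
vanishes, (1, 1) lies in the kernel, so adding it to a solution contradicts uniqueness. -/
lemma systemII_existsUnique_iff (x₀ x₁ y₀ y₁ : ℂ) :
    (∃! q : ℂ × ℂ, systemII y₀ x₁ q.1 x₀ y₁ q.2) ↔ x₀ * y₁ - y₀ * x₁ ≠ 0 := by
  constructor
  · rintro ⟨⟨u, v⟩, ⟨h1, h2⟩, huniq⟩ h0
    have := huniq (u + 1, v + 1) ⟨by linear_combination h1 - h0, by linear_combination h2⟩
    simp at this
  · intro h
    refine ⟨(x₀ * y₁ * (x₀ + y₁ - y₀ - x₁) / (x₀ * y₁ - y₀ * x₁),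
      y₀ * x₁ * (x₀ + y₁ - y₀ - x₁) / (x₀ * y₁ - y₀ * x₁)), ⟨?_, ?_⟩, ?_⟩
    · field_simp
    · field_simp
      ring
    · rintro ⟨u, v⟩ ⟨h1, h2⟩
      simp only at h1 h2
      ext
      · simp only
        rw [eq_div_iff h]
        linear_combination x₀ * y₁ * h2 - h1
      · simp only
        rw [eq_div_iff h]
        linear_combination y₀ * x₁ * h2 - h1

/-- The first equation fixes u - v = x₀ + y₁ - y₀ - x₁. Since u² - v² = (u - v)(u + v), the second
then fixes u + v exactly when this number is nonzero. -/
lemma systemIV_existsUnique_iff (x₀ x₁ y₀ y₁ : ℂ) :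
    (∃! q : ℂ × ℂ, systemIV y₀ x₁ q.1 x₀ y₁ q.2) ↔ x₀ + y₁ - y₀ - x₁ ≠ 0 := by
  constructor
  · rintro ⟨⟨u, v⟩, ⟨h1, h2⟩, huniq⟩ h0
    simp only at h1 h2
    have := huniq (u + 1, v + 1)
      ⟨by linear_combination h1, by linear_combination h2 + 2 * h1 + 2 * h0⟩
    simp at this
  · intro h
    refine ⟨(((x₀ ^ 2 + y₁ ^ 2 - y₀ ^ 2 - x₁ ^ 2) / (x₀ + y₁ - y₀ - x₁) +
        (x₀ + y₁ - y₀ - x₁)) / 2,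
      ((x₀ ^ 2 + y₁ ^ 2 - y₀ ^ 2 - x₁ ^ 2) / (x₀ + y₁ - y₀ - x₁) -
        (x₀ + y₁ - y₀ - x₁)) / 2), ⟨?_, ?_⟩, ?_⟩
    · ring
    · field_simp
      ring
    · rintro ⟨u, v⟩ ⟨h1, h2⟩
      simp only at h1 h2
      have hsum : u + v = (x₀ ^ 2 + y₁ ^ 2 - y₀ ^ 2 - x₁ ^ 2) / (x₀ + y₁ - y₀ - x₁) := by
        rw [eq_div_iff h]
        linear_combination h2 - (u + v) * h1
      ext
      · simp only
        rw [← hsum]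
        linear_combination h1 / 2
      · simp only
        rw [← hsum]
        linear_combination -h1 / 2

/-- The second system as the limit of the first one under a divergent common translation. -/
lemma systemIV_of_tendsto {α : Type*} {l : Filter α} [l.NeBot] {Z a₀ a₁ a₂ b₀ b₁ b₂ : α → ℂ}
    {x₀ x₁ x₂ y₀ y₁ y₂ : ℂ} (hZ : Tendsto (fun t => (Z t)⁻¹) l (𝓝 0)) (hZ0 : ∀ᶠ t in l, Z t ≠ 0)
    (ha₀ : Tendsto a₀ l (𝓝 x₀)) (ha₁ : Tendsto a₁ l (𝓝 x₁)) (ha₂ : Tendsto a₂ l (𝓝 x₂))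
    (hb₀ : Tendsto b₀ l (𝓝 y₀)) (hb₁ : Tendsto b₁ l (𝓝 y₁)) (hb₂ : Tendsto b₂ l (𝓝 y₂))
    (h : ∀ᶠ t in l,
      systemII (Z t + a₀ t) (Z t + a₁ t) (Z t + a₂ t) (Z t + b₀ t) (Z t + b₁ t) (Z t + b₂ t)) :
    systemIV x₀ x₁ x₂ y₀ y₁ y₂ := by
  have h1 : x₀ + x₁ + x₂ = y₀ + y₁ + y₂ := by
    refine tendsto_nhds_unique_of_eventuallyEq ((ha₀.add ha₁).add ha₂) ((hb₀.add hb₁).add hb₂) ?_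
    filter_upwards [h] with t ht
    linear_combination ht.2
  -- In the expansion of the product equation in Z, the cubic terms agree and the quadratic ones
  -- cancel by the sum equation. Dividing the rest by Z shows that the second elementary symmetric
  -- functions agree in the limit.
  have h2 : (x₀ * x₁ + x₀ * x₂ + x₁ * x₂) - (y₀ * y₁ + y₀ * y₂ + y₁ * y₂) =
      (y₀ * y₁ * y₂ - x₀ * x₁ * x₂) * 0 := by
    refine tendsto_nhds_unique_of_eventuallyEq
      ((((ha₀.mul ha₁).add (ha₀.mul ha₂)).add (ha₁.mul ha₂)).sub
        (((hb₀.mul hb₁).add (hb₀.mul hb₂)).add (hb₁.mul hb₂)))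
      ((((hb₀.mul hb₁).mul hb₂).sub ((ha₀.mul ha₁).mul ha₂)).mul hZ) ?_
    filter_upwards [h, hZ0] with t ht hz
    rw [← div_eq_mul_inv, eq_div_iff hz]
    linear_combination ht.1 - Z t ^ 2 * ht.2
  exact ⟨h1, by linear_combination (x₀ + x₁ + x₂ + y₀ + y₁ + y₂) * h1 - 2 * h2⟩

/-! ### The systems for the parametrized variables -/

/-- The new variable produced by `σ` under the substitution by `F̂`. -/
noncomputable def barII (f : ℂ → ℂ) (A C P Q h₁ h₂ : ℂ) : ℂ :=
  zetaFn f (C - A) - zetaFn f (h₁ - A - P) - zetaFn f (h₂ - A - Q) +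
    zetaFn f (h₁ + h₂ - A - C - P - Q)

/-- The new variable produced by `σ` under the substitution by the second degeneration. -/
noncomputable def barIV (f : ℂ → ℂ) (A P Q h₁ h₂ : ℂ) : ℂ :=
  -zetaFn f (h₁ - A - P) - zetaFn f (h₂ - A - Q) + zetaFn f (h₁ + h₂ - 2 * A - P - Q)

namespace SigmaLike

variable {f : ℂ → ℂ} (hf : SigmaLike f)
include hf

lemma hatF_eq_div {A C u h : ℂ} (h1 : f (C - A) ≠ 0) (h2 : f (h - A - C) ≠ 0)
    (h3 : f (u - A) ≠ 0) (h4 : f (h - A - u) ≠ 0) :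
    hatF f A C u h = f (h - 2 * A) * f (C - u) * f (u + C - h) /
      (f (C - A) * f (h - A - C) * f (u - A) * f (h - A - u)) := by
  rw [hatF, hf.zetaFn_add_sub_add (by ring) h1 h2 h3 h4]
  have e1 : C - A + (h - A - C) = h - 2 * A := by ring
  have e2 : C - A - (u - A) = C - u := by ring
  have e3 : u - A - (h - A - C) = u + C - h := by ring
  rw [e1, e2, e3]

lemma barII_eq_div {A C P Q h₁ h₂ : ℂ} (h1 : f (C - A) ≠ 0) (h2 : f (h₁ - A - P) ≠ 0)
    (h3 : f (h₂ - A - Q) ≠ 0) (h4 : f (h₁ + h₂ - A - C - P - Q) ≠ 0) :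
    barII f A C P Q h₁ h₂ =
      f (h₁ + h₂ - 2 * A - P - Q) * f (P + C - h₁) * f (Q + C - h₂) /
      (f (C - A) * f (h₁ + h₂ - A - C - P - Q) * f (h₁ - A - P) * f (h₂ - A - Q)) := by
  have h := hf.zetaFn_add_sub_add (a := C - A) (b := h₁ + h₂ - A - C - P - Q) (c := h₁ - A - P)
    (d := h₂ - A - Q) (by ring) h1 h4 h2 h3
  have e1 : C - A + (h₁ + h₂ - A - C - P - Q) = h₁ + h₂ - 2 * A - P - Q := by ring
  have e2 : C - A - (h₁ - A - P) = P + C - h₁ := by ring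
  have e3 : h₁ - A - P - (h₁ + h₂ - A - C - P - Q) = Q + C - h₂ := by ring
  rw [e1, e2, e3] at h
  rw [barII]
  linear_combination h

/-- The sum equation is a cancellation of ζ-terms. In product form, both sides of the other equation
have the same factors. -/
lemma systemII_hatF {A C P Q h₁ h₂ : ℂ} (hCA : f (C - A) ≠ 0) (h1C : f (h₁ - A - C) ≠ 0)
    (h2C : f (h₂ - A - C) ≠ 0) (hP : f (P - A) ≠ 0) (hQ : f (Q - A) ≠ 0)
    (h1P : f (h₁ - A - P) ≠ 0) (h2P : f (h₂ - A - P) ≠ 0) (h1Q : f (h₁ - A - Q) ≠ 0)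
    (h2Q : f (h₂ - A - Q) ≠ 0) (hE : f (h₁ + h₂ - A - C - P - Q) ≠ 0) :
    systemII (hatF f A C P h₂) (hatF f A C Q h₁) (barII f A C P Q h₁ h₂)
      (hatF f A C P h₁) (hatF f A C Q h₂) (barII f A C P Q h₂ h₁) := by
  constructor
  · rw [hf.barII_eq_div hCA h1P h2Q hE, hf.barII_eq_div hCA h2P h1Q (by rwa [add_comm h₂ h₁]),
      hf.hatF_eq_div hCA h2C hP h2P, hf.hatF_eq_div hCA h1C hQ h1Q,
      hf.hatF_eq_div hCA h1C hP h1P, hf.hatF_eq_div hCA h2C hQ h2Q, add_comm h₂ h₁]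
    field_simp
  · rw [barII, barII, hatF, hatF, hatF, hatF, add_comm h₂ h₁]
    ring

lemma hatF_det {A C P Q h₁ h₂ : ℂ} (hCA : f (C - A) ≠ 0) (h1C : f (h₁ - A - C) ≠ 0)
    (h2C : f (h₂ - A - C) ≠ 0) (hP : f (P - A) ≠ 0) (hQ : f (Q - A) ≠ 0)
    (h1P : f (h₁ - A - P) ≠ 0) (h2P : f (h₂ - A - P) ≠ 0) (h1Q : f (h₁ - A - Q) ≠ 0)
    (h2Q : f (h₂ - A - Q) ≠ 0) :
    hatF f A C P h₁ * hatF f A C Q h₂ - hatF f A C P h₂ * hatF f A C Q h₁ =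
      f (h₁ - 2 * A) * f (h₂ - 2 * A) * f (C - P) * f (C - Q) * f (h₁ - h₂) * f (P - Q) *
        f (h₁ + h₂ - A - C - P - Q) /
      (f (C - A) * f (h₁ - A - C) * f (h₂ - A - C) * f (P - A) * f (Q - A) * f (h₁ - A - P) *
        f (h₂ - A - P) * f (h₁ - A - Q) * f (h₂ - A - Q)) := by
  -- Over a common denominator the determinant is a difference of two products, which this instance
  -- of the three-term relation merges into one.
  have h3 := hf.three_term (a := P + C - h₂) (b := h₂ - A - Q) (c := C - A) (d := P - Q)
    (e := P + C - h₁) (g := h₁ - A - Q) (by ring) (by ring)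
  have e1 : P + C - h₂ - (C - A) = -(h₂ - A - P) := by ring
  have e2 : C - A - (h₂ - A - Q) = Q + C - h₂ := by ring
  have e3 : C - A - (P + C - h₁) = h₁ - A - P := by ring
  have e4 : P + C - h₁ - (P - Q) = Q + C - h₁ := by ring
  have e5 : P + C - h₁ - (P + C - h₂) = -(h₁ - h₂) := by ring
  have e6 : P + C - h₂ - (h₁ - A - Q) = -(h₁ + h₂ - A - C - P - Q) := by ring
  rw [e1, e2, e3, e4, e5, e6, hf.neg, hf.neg, hf.neg] at h3
  rw [hf.hatF_eq_div hCA h1C hP h1P, hf.hatF_eq_div hCA h2C hQ h2Q,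
    hf.hatF_eq_div hCA h2C hP h2P, hf.hatF_eq_div hCA h1C hQ h1Q]
  field_simp
  linear_combination -(f (h₁ - 2 * A) * f (C - P) * f (h₂ - 2 * A) * f (C - Q)) * h3

lemma hatF_det_ne_zero_iff {A C P Q h₁ h₂ : ℂ} (hCA : f (C - A) ≠ 0) (h1C : f (h₁ - A - C) ≠ 0)
    (h2C : f (h₂ - A - C) ≠ 0) (hP : f (P - A) ≠ 0) (hQ : f (Q - A) ≠ 0)
    (h1P : f (h₁ - A - P) ≠ 0) (h2P : f (h₂ - A - P) ≠ 0) (h1Q : f (h₁ - A - Q) ≠ 0)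
    (h2Q : f (h₂ - A - Q) ≠ 0) :
    hatF f A C P h₁ * hatF f A C Q h₂ - hatF f A C P h₂ * hatF f A C Q h₁ ≠ 0 ↔
      f (h₁ - 2 * A) ≠ 0 ∧ f (h₂ - 2 * A) ≠ 0 ∧ f (C - P) ≠ 0 ∧ f (C - Q) ≠ 0 ∧
        f (h₁ - h₂) ≠ 0 ∧ f (P - Q) ≠ 0 ∧ f (h₁ + h₂ - A - C - P - Q) ≠ 0 := by
  rw [hf.hatF_det hCA h1C h2C hP hQ h1P h2P h1Q h2Q]
  simp only [ne_eq, div_eq_zero_iff, mul_eq_zero, not_or]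
  tauto

lemma hathatF_det_ne_zero_iff {A P Q h₁ h₂ : ℂ} (h1P : f (h₁ - A - P) ≠ 0)
    (h2P : f (h₂ - A - P) ≠ 0) (h1Q : f (h₁ - A - Q) ≠ 0) (h2Q : f (h₂ - A - Q) ≠ 0) :
    hathatF f A P h₁ + hathatF f A Q h₂ - hathatF f A P h₂ - hathatF f A Q h₁ ≠ 0 ↔
      f (h₁ - h₂) ≠ 0 ∧ f (P - Q) ≠ 0 ∧ f (h₁ + h₂ - 2 * A - P - Q) ≠ 0 := by
  have h := hf.zetaFn_add_sub_add (a := h₂ - A - P) (b := h₁ - A - Q) (c := h₁ - A - P)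
    (d := h₂ - A - Q) (by ring) h2P h1Q h1P h2Q
  have e1 : h₂ - A - P + (h₁ - A - Q) = h₁ + h₂ - 2 * A - P - Q := by ring
  have e2 : h₂ - A - P - (h₁ - A - P) = -(h₁ - h₂) := by ring
  have e3 : h₁ - A - P - (h₁ - A - Q) = -(P - Q) := by ring
  rw [e1, e2, e3, hf.neg, hf.neg] at h
  have hdet : hathatF f A P h₁ + hathatF f A Q h₂ - hathatF f A P h₂ - hathatF f A Q h₁ =
      zetaFn f (h₂ - A - P) + zetaFn f (h₁ - A - Q) - zetaFn f (h₁ - A - P) -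
        zetaFn f (h₂ - A - Q) := by
    simp only [hathatF]
    ring
  rw [hdet, h]
  simp only [ne_eq, div_eq_zero_iff, mul_eq_zero, neg_eq_zero, not_or]
  tauto

/-- Put C = A + t in `systemII_hatF`. Each of the six variables is ζ(t) plus a term tending to its
counterpart here, and ζ(t) diverges as t → 0. -/
lemma systemIV_hathatF {A P Q h₁ h₂ : ℂ} (h1A : f (h₁ - 2 * A) ≠ 0) (h2A : f (h₂ - 2 * A) ≠ 0)
    (hP : f (P - A) ≠ 0) (hQ : f (Q - A) ≠ 0)
    (h1P : f (h₁ - A - P) ≠ 0) (h2P : f (h₂ - A - P) ≠ 0) (h1Q : f (h₁ - A - Q) ≠ 0)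
    (h2Q : f (h₂ - A - Q) ≠ 0) (hE : f (h₁ + h₂ - 2 * A - P - Q) ≠ 0) :
    systemIV (hathatF f A P h₂) (hathatF f A Q h₁) (barIV f A P Q h₁ h₂)
      (hathatF f A P h₁) (hathatF f A Q h₂) (barIV f A P Q h₂ h₁) := by
  have hd := hf.differentiable
  have hfc : Tendsto f (𝓝[≠] 0) (𝓝 0) := by
    simpa [hf.map_zero] using (hd.continuous.tendsto 0).mono_left nhdsWithin_le_nhds
  have hfd : Tendsto (deriv f) (𝓝[≠] 0) (𝓝 1) := by
    simpa [hf.deriv_zero] using (hd.deriv.continuous.tendsto 0).mono_left nhdsWithin_le_nhds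
  have hf0 : ∀ᶠ t in 𝓝[≠] (0 : ℂ), f t ≠ 0 := by simpa using hf.eventually_ne 0 one_ne_zero
  have hZ : Tendsto (fun t => (zetaFn f t)⁻¹) (𝓝[≠] 0) (𝓝 0) := by
    simpa [zetaFn, inv_div] using! hfc.div hfd one_ne_zero
  have hZ0 : ∀ᶠ t in 𝓝[≠] (0 : ℂ), zetaFn f t ≠ 0 := by
    filter_upwards [hf0, hfd.eventually_ne one_ne_zero] with t h1 h2
    exact div_ne_zero h2 h1
  have hζ : ∀ a : ℂ, f a ≠ 0 → Tendsto (fun t => zetaFn f (a - t)) (𝓝[≠] 0) (𝓝 (zetaFn f a)) := by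
    intro a ha
    have h1 : ContinuousAt (zetaFn f) (a - 0) :=
      (hasDerivAt_zetaFn hd (by simpa using ha)).continuousAt
    have h2 : ContinuousAt (fun t => zetaFn f (a - t)) 0 :=
      ContinuousAt.comp (f := fun t => a - t) h1 (by fun_prop)
    simpa using h2.tendsto.mono_left nhdsWithin_le_nhds
  have hev : ∀ a : ℂ, f a ≠ 0 → ∀ᶠ t in 𝓝[≠] (0 : ℂ), f (a - t) ≠ 0 := fun a _ => by
    simpa [sub_eq_add_neg] using hf.eventually_ne a (neg_ne_zero.mpr one_ne_zero)
  refine systemIV_of_tendsto (Z := zetaFn f) hZ hZ0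
    (((hζ _ h2A).sub_const (zetaFn f (P - A))).sub_const (zetaFn f (h₂ - A - P)))
    (((hζ _ h1A).sub_const (zetaFn f (Q - A))).sub_const (zetaFn f (h₁ - A - Q)))
    ((hζ _ hE).const_add (-zetaFn f (h₁ - A - P) - zetaFn f (h₂ - A - Q)))
    (((hζ _ h1A).sub_const (zetaFn f (P - A))).sub_const (zetaFn f (h₁ - A - P)))
    (((hζ _ h2A).sub_const (zetaFn f (Q - A))).sub_const (zetaFn f (h₂ - A - Q)))
    (((hζ _ (by rwa [add_comm h₂ h₁])).const_add
      (-zetaFn f (h₂ - A - P) - zetaFn f (h₁ - A - Q)))) ?_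
  filter_upwards [hf0, hev _ h1A, hev _ h2A, hev _ hE] with t ht h1 h2 h3
  have e1 : ∀ h, h - A - (A + t) = h - 2 * A - t := fun h => by ring
  have e2 : ∀ h, h - 2 * A - t - P - Q = h - 2 * A - P - Q - t := fun h => by ring
  have key := hf.systemII_hatF (A := A) (C := A + t) (P := P) (Q := Q) (h₁ := h₁) (h₂ := h₂)
    (by simpa using ht) (by rwa [e1]) (by rwa [e1]) hP hQ h1P h2P h1Q h2Q (by rwa [e1, e2])
  simp only [hatF, barII, e1, e2, add_sub_cancel_left] at key ⊢
  convert key using 1 <;> ring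

end SigmaLike

/-! ### Relatively open and dense subsets -/

/-- `A ∩ V` is relatively open and dense in `V`. -/
def RelOpenDense {X : Type*} [TopologicalSpace X] (V A : Set X) : Prop :=
  IsOpen ((↑) ⁻¹' A : Set V) ∧ Dense ((↑) ⁻¹' A : Set V)

namespace RelOpenDense

variable {X : Type*} [TopologicalSpace X] {V A B : Set X}

lemma congr (hA : RelOpenDense V A) (h : ∀ p ∈ V, p ∈ A ↔ p ∈ B) : RelOpenDense V B := by
  have : ((↑) ⁻¹' A : Set V) = (↑) ⁻¹' B := by
    ext p
    exact h p p.2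
  rwa [RelOpenDense, ← this]

lemma inter (hA : RelOpenDense V A) (hB : RelOpenDense V B) :
    RelOpenDense V {p | p ∈ A ∧ p ∈ B} :=
  ⟨hA.1.inter hB.1, hA.2.inter_of_isOpen_left hB.2 hA.1⟩

lemma univ : RelOpenDense V Set.univ := ⟨isOpen_univ, dense_univ⟩

lemma forall_mem {ι : Type*} (s : Finset ι) {A : ι → Set X} (h : ∀ i ∈ s, RelOpenDense V (A i)) :
    RelOpenDense V {p | ∀ i ∈ s, p ∈ A i} := by
  classical
  induction s using Finset.induction_on with
  | empty => exact univ.congr fun p _ => by simp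
  | insert a s _ ih =>
    refine ((h a (by simp)).inter (ih fun i hi => h i (by simp [hi]))).congr fun p _ => ?_
    simp

lemma forall_fintype {ι : Type*} [Fintype ι] {A : ι → Set X} (h : ∀ i, RelOpenDense V (A i)) :
    RelOpenDense V {p | ∀ i, p ∈ A i} :=
  (forall_mem Finset.univ fun i _ => h i).congr fun p _ => by simp

lemma imp {P : Prop} (h : P → RelOpenDense V A) : RelOpenDense V {p | P → p ∈ A} := by
  by_cases hP : P
  · exact (h hP).congr fun p _ => by simp [hP]
  · exact univ.congr fun p _ => by simp [hP]

/-- A continuous involution preserving V restricts to a homeomorphism of V. -/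
lemma preimage {T : X → X} (hT : Continuous T) (hinv : ∀ p, T (T p) = p)
    (hV : ∀ p ∈ V, T p ∈ V) (hA : RelOpenDense V A) : RelOpenDense V (T ⁻¹' A) := by
  let e : V ≃ₜ V :=
    { toFun := fun p => ⟨T p, hV p p.2⟩
      invFun := fun p => ⟨T p, hV p p.2⟩
      left_inv := fun p => Subtype.ext (hinv p)
      right_inv := fun p => Subtype.ext (hinv p)
      continuous_toFun := by fun_prop
      continuous_invFun := by fun_prop }
  exact ⟨hA.1.preimage e.continuous, hA.2.preimage e.isOpenMap⟩

end RelOpenDense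

/-- Along a line in V in the direction v, the form l is affine with slope k ≠ 0, so the zeros of f ∘
l on it are isolated. -/
lemma SigmaLike.relOpenDense {f : ℂ → ℂ} (hf : SigmaLike f) {X : Type*} [TopologicalSpace X]
    [AddCommGroup X] [Module ℂ X] [ContinuousAdd X] [ContinuousSMul ℂ X] {V : Set X} {l : X → ℂ}
    (hl : Continuous l) (v : X) {k : ℂ} (hk : k ≠ 0) (hV : ∀ p ∈ V, ∀ t : ℂ, p + t • v ∈ V)
    (hlv : ∀ (p : X) (t : ℂ), l (p + t • v) = l p + k * t) :
    RelOpenDense V {p | f (l p) ≠ 0} := by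
  constructor
  · have : Continuous fun p : V => f (l p) :=
      hf.differentiable.continuous.comp (hl.comp continuous_subtype_val)
    exact isOpen_ne.preimage this
  · intro p
    have hc : Continuous fun t : ℂ => (⟨p + t • v, hV p p.2 t⟩ : V) := by fun_prop
    have h0 := (hc.tendsto 0).mono_left (nhdsWithin_le_nhds (s := {0}ᶜ))
    simp only [zero_smul, add_zero] at h0
    refine mem_closure_of_tendsto h0 ?_
    filter_upwards [hf.eventually_ne (l p) hk] with t ht
    simpa [hlv] using ht

/-! ### Realizations of partial maps by maps of the parameters -/

/-- The map `T` of the parameters realizes the partial map `t` on `V` under the substitution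
`sub`, generically on `V` and wherever `t` is defined. -/
structure Realizes {n : ℕ} (V regular : Set (Params n)) (sub : Params n → Config n)
    (t : Config n →. Config n) (T : Params n → Params n) : Prop where
  mapsTo : ∀ p ∈ V, T p ∈ V
  preimage : ∀ A, RelOpenDense V A → RelOpenDense V (T ⁻¹' A)
  domain : RelOpenDense V {p | p ∈ regular ∧ (t (sub p)).Dom}
  map : ∀ p ∈ V, p ∈ regular → (t (sub p)).Dom → T p ∈ regular ∧ sub (T p) ∈ t (sub p)

namespace Realizes

variable {n : ℕ} {V regular : Set (Params n)} {sub : Params n → Config n}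
  {a b : Config n →. Config n} {A B T : Params n → Params n}

lemma dom_mulMap {x y : Config n} (h : y ∈ a x) : (mulMap a b x).Dom ↔ (b y).Dom := by
  rw [mulMap, PFun.comp_apply, Part.eq_some_iff.mpr h]
  exact iff_of_eq (congrArg Part.Dom (Part.bind_some y b))

lemma mem_mulMap {x y z : Config n} (h : y ∈ a x) (h' : z ∈ b y) : z ∈ mulMap a b x := by
  rw [mulMap, PFun.comp_apply]
  exact Part.mem_bind h h'

lemma dom_of_dom_mulMap {x : Config n} (h : (mulMap a b x).Dom) : (a x).Dom := by
  rw [mulMap, PFun.comp_apply] at h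
  exact h.1

/-- Regularity at `A p` is part of what `ha` provides, so `hb` applies there. The domain of the
product is that of a intersected with the preimage under `A` of that of b. -/
lemma mul (ha : Realizes V regular sub a A) (hb : Realizes V regular sub b B) :
    Realizes V regular sub (mulMap a b) (fun p => B (A p)) where
  mapsTo p hp := hb.mapsTo _ (ha.mapsTo p hp)
  preimage S hS := ha.preimage _ (hb.preimage S hS)
  domain := by
    refine (ha.domain.inter (ha.preimage _ hb.domain)).congr fun p hp => ⟨?_, ?_⟩
    · rintro ⟨⟨h1, h2⟩, -, h4⟩
      exact ⟨h1, (dom_mulMap (ha.map p hp h1 h2).2).mpr h4⟩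
    · rintro ⟨h1, h2⟩
      have h3 := dom_of_dom_mulMap h2
      obtain ⟨h4, h5⟩ := ha.map p hp h1 h3
      exact ⟨⟨h1, h3⟩, h4, (dom_mulMap h5).mp h2⟩
  map p hp h1 h2 := by
    obtain ⟨h4, h5⟩ := ha.map p hp h1 (dom_of_dom_mulMap h2)
    obtain ⟨h6, h7⟩ := hb.map _ (ha.mapsTo p hp) h4 ((dom_mulMap h5).mp h2)
    exact ⟨h6, mem_mulMap h5 h7⟩

lemma compatible (h : Realizes V regular sub a A) : Compatible V regular sub a A := by
  have hD : {p | p ∈ V ∧ p ∈ regular ∧ A p ∈ regular ∧ (a (sub p)).Dom} =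
      V ∩ {p | p ∈ regular ∧ (a (sub p)).Dom} := by
    ext p
    constructor
    · rintro ⟨h1, h2, -, h4⟩
      exact ⟨h1, h2, h4⟩
    · rintro ⟨h1, h2, h4⟩
      exact ⟨h1, h2, (h.map p h1 h2 h4).1, h4⟩
  refine ⟨h.mapsTo, fun p hp => (h.map p hp.1 hp.2.1 hp.2.2.2).2, ?_, ?_⟩
  · obtain ⟨U, hU, hUV⟩ := isOpen_induced_iff.mp h.domain.1
    refine ⟨U, hU, ?_⟩
    rw [hD, Set.inter_comm U V, ← Subtype.image_preimage_coe, ← Subtype.image_preimage_coe, hUV]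
  · rw [hD, ← Subtype.image_preimage_coe]
    exact Subtype.dense_iff.mp h.domain.2

end Realizes

/-! ### The linear maps realizing `ω` and `σ_j` -/

section Linear

variable {n : ℕ}

/-- The interchange of `h₁` and `h₂`. -/
def swapParams (p : Params n) : Params n := (![p.1 1, p.1 0], p.2)

/-- The map of the parameters realizing `σ_j`. -/
noncomputable def sigmaParams (j : Fin n) (p : Params n) : Params n :=
  (![p.2 0 + p.2 1 + p.2 2 + p.2 (j.addNat 3) - p.1 0 - 2 * p.1 1, -p.1 1],
    fun i => if (i : ℕ) < 3 ∨ i = j.addNat 3 then p.2 i - p.1 1 else -p.2 i)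

lemma swapParams_h_zero (p : Params n) : (swapParams p).1 0 = p.1 1 := rfl
lemma swapParams_h_one (p : Params n) : (swapParams p).1 1 = p.1 0 := rfl
lemma swapParams_k (p : Params n) : (swapParams p).2 = p.2 := rfl

lemma addNat_three_ne {i j : Fin n} (hij : i ≠ j) : i.addNat 3 ≠ j.addNat 3 := fun h =>
  hij (Fin.ext (Nat.add_right_cancel (congrArg Fin.val h)))

lemma swapParams_swapParams (p : Params n) : swapParams (swapParams p) = p := by
  refine Prod.ext (funext fun a => ?_) rfl
  fin_cases a <;> rfl

lemma sigmaParams_k {p : Params n} {j : Fin n} {i : Fin (n + 3)} (hi : (i : ℕ) < 3) :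
    (sigmaParams j p).2 i = p.2 i - p.1 1 := by
  simp [sigmaParams, hi]

lemma sigmaParams_k_self (p : Params n) (j : Fin n) :
    (sigmaParams j p).2 (j.addNat 3) = p.2 (j.addNat 3) - p.1 1 := by
  simp [sigmaParams]

lemma sigmaParams_k_of_ne (p : Params n) {i j : Fin n} (hij : i ≠ j) :
    (sigmaParams j p).2 (i.addNat 3) = -p.2 (i.addNat 3) := by
  simp [sigmaParams, addNat_three_ne hij]

lemma zero_lt_three : ((0 : Fin (n + 3)) : ℕ) < 3 := by simp
lemma one_lt_three : ((1 : Fin (n + 3)) : ℕ) < 3 := by simp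
lemma two_lt_three : ((2 : Fin (n + 3)) : ℕ) < 3 := by
  change 2 % (n + 3) < 3
  rw [Nat.mod_eq_of_lt (by omega)]
  omega

lemma sigmaParams_k_zero (p : Params n) (j : Fin n) : (sigmaParams j p).2 0 = p.2 0 - p.1 1 :=
  sigmaParams_k zero_lt_three

lemma sigmaParams_k_one (p : Params n) (j : Fin n) : (sigmaParams j p).2 1 = p.2 1 - p.1 1 :=
  sigmaParams_k one_lt_three

lemma sigmaParams_k_two (p : Params n) (j : Fin n) : (sigmaParams j p).2 2 = p.2 2 - p.1 1 :=
  sigmaParams_k two_lt_three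

lemma sigmaParams_h_zero (p : Params n) (j : Fin n) : (sigmaParams j p).1 0 =
    p.2 0 + p.2 1 + p.2 2 + p.2 (j.addNat 3) - p.1 0 - 2 * p.1 1 := rfl

lemma sigmaParams_h_one (p : Params n) (j : Fin n) : (sigmaParams j p).1 1 = -p.1 1 := rfl

lemma sigmaParams_sigmaParams (j : Fin n) (p : Params n) :
    sigmaParams j (sigmaParams j p) = p := by
  refine Prod.ext (funext fun a => ?_) (funext fun i => ?_)
  · fin_cases a
    · change (sigmaParams j (sigmaParams j p)).1 0 = p.1 0
      rw [sigmaParams_h_zero, sigmaParams_k_zero, sigmaParams_k_one, sigmaParams_k_two,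
        sigmaParams_k_self, sigmaParams_h_zero, sigmaParams_h_one]
      ring
    · change (sigmaParams j (sigmaParams j p)).1 1 = p.1 1
      rw [sigmaParams_h_one, sigmaParams_h_one, neg_neg]
  · by_cases hi : (i : ℕ) < 3 ∨ i = j.addNat 3 <;> simp [sigmaParams, hi]

lemma continuous_swapParams : Continuous (swapParams (n := n)) := by
  refine Continuous.prodMk (continuous_pi fun a => ?_) continuous_snd
  fin_cases a <;> simp <;> fun_prop

lemma continuous_sigmaParams (j : Fin n) : Continuous (sigmaParams j) := by
  refine Continuous.prodMk (continuous_pi fun a => ?_) (continuous_pi fun i => ?_)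
  · fin_cases a <;> simp <;> fun_prop
  · by_cases hi : (i : ℕ) < 3 ∨ i = j.addNat 3 <;> simp only [hi, if_true, if_false] <;> fun_prop

/-- The product of `σ_a` and `σ_b` on the parameters is an elementary transformation. -/
lemma sigmaParams_comp {a b : Fin n} (hab : a ≠ b) (p : Params n) :
    sigmaParams b (sigmaParams a p) =
      (![p.1 0 + p.1 1 - p.2 (a.addNat 3) - p.2 (b.addNat 3), p.1 1],
        fun i => if i = a.addNat 3 ∨ i = b.addNat 3 then p.1 1 - p.2 i else p.2 i) := by
  have hab' := addNat_three_ne hab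
  refine Prod.ext (funext fun c => ?_) (funext fun i => ?_)
  · fin_cases c
    · change (sigmaParams b (sigmaParams a p)).1 0 = _
      rw [sigmaParams_h_zero, sigmaParams_k_zero, sigmaParams_k_one, sigmaParams_k_two,
        sigmaParams_k_of_ne _ hab.symm, sigmaParams_h_zero, sigmaParams_h_one]
      simp
      ring
    · change (sigmaParams b (sigmaParams a p)).1 1 = _
      rw [sigmaParams_h_one, sigmaParams_h_one, neg_neg]
      rfl
  · by_cases hi : (i : ℕ) < 3
    · have hia : i ≠ a.addNat 3 := fun h => by rw [h] at hi; simp at hi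
      have hib : i ≠ b.addNat 3 := fun h => by rw [h] at hi; simp at hi
      simp [sigmaParams, hi, hia, hib]
    · by_cases hia : i = a.addNat 3
      · subst hia
        simp [sigmaParams, hab']
      · by_cases hib : i = b.addNat 3
        · subst hib
          simp [sigmaParams, hab'.symm]
          ring
        · simp [sigmaParams, hi, hia, hib]

end Linear

/-! ### The words in `ω` and `σ_j` -/

/-- Only linear identities remain to be checked after `Realizes.mul`. From `t₃` on, adjacent
involutions are merged by `sigmaParams_comp`, in which k₁, k₂, k₃ no longer enter. -/
lemma Realizes.tMap {m n : ℕ} (hm : 1 < m) (hmn : m ≤ n) {S : System}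
    {V regular : Set (Params n)} {sub : Params n → Config n}
    (hω : Realizes V regular sub omegaMap swapParams)
    (hσ : ∀ j, Realizes V regular sub (sigmaMap S j) (sigmaParams j)) {j : Fin (m + 3)}
    (hj : j ≠ 0) : Realizes V regular sub (tMap hm hmn S j) (linMap hm hmn j) := by
  obtain ⟨j, hjm⟩ := j
  match j, hjm, hj with
  | 0, _, hj => exact absurd rfl hj
  | 1, _, _ => exact hω
  | 2, _, _ =>
    have hn : 3 < n + 3 := by omega
    have h := (hσ ⟨0, by omega⟩).mul (hω.mul (hσ ⟨0, by omega⟩))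
    have hT : linMap (n := n) hm hmn ⟨2, by omega⟩ = fun p => sigmaParams ⟨0, by omega⟩
        (swapParams (sigmaParams ⟨0, by omega⟩ p)) := by
      funext p
      refine Prod.ext (funext fun a => ?_) (funext fun i => ?_)
      · fin_cases a
        · change _ = (sigmaParams _ (swapParams (sigmaParams _ p))).1 0
          simp only [sigmaParams_h_zero, sigmaParams_h_one, swapParams_h_zero, swapParams_h_one,
            swapParams_k, sigmaParams_k_zero, sigmaParams_k_one, sigmaParams_k_two,
            sigmaParams_k_self]
          simp [linMap]
          ring
        · simp [linMap, sigmaParams, swapParams]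
          ring
      · by_cases hi : (i : ℕ) < 3
        · have hi' : (i : ℕ) < 4 := by omega
          simp [linMap, sigmaParams, swapParams, hi, hi']
          ring
        · by_cases hi3 : i = ⟨3, hn⟩
          · subst hi3
            simp [linMap, sigmaParams, swapParams]
            ring
          · have hi' : ¬ (i : ℕ) < 4 := fun h => hi3 (Fin.ext (by simp; omega))
            simp [linMap, sigmaParams, swapParams, hi, hi', hi3]
    rw [hT]
    exact h
  | 3, _, _ =>
    have h := hω.mul ((hσ ⟨0, by omega⟩).mul ((hσ ⟨1, by omega⟩).mul (hω.mul
      ((hσ ⟨1, by omega⟩).mul ((hσ ⟨0, by omega⟩).mul hω)))))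
    have hT : linMap (n := n) hm hmn ⟨3, by omega⟩ = fun p => swapParams (sigmaParams ⟨0, by omega⟩
        (sigmaParams ⟨1, by omega⟩ (swapParams (sigmaParams ⟨1, by omega⟩
          (sigmaParams ⟨0, by omega⟩ (swapParams p)))))) := by
      funext p
      rw [sigmaParams_comp (by simp), sigmaParams_comp (by simp)]
      refine Prod.ext (funext fun a => ?_) (funext fun i => ?_)
      · fin_cases a
        · simp [linMap, swapParams]
          ring
        · simp [linMap, swapParams]
      · by_cases h3 : i = ⟨3, by omega⟩
        · subst h3
          simp [linMap, swapParams]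
          ring
        · by_cases h4 : i = ⟨4, by omega⟩
          · subst h4
            simp [linMap, swapParams]
            ring
          · have h3' : ¬ (i : ℕ) = 3 := fun h => h3 (Fin.ext h)
            have h4' : ¬ (i : ℕ) = 4 := fun h => h4 (Fin.ext h)
            simp [linMap, swapParams, h3, h4, h3', h4']
    rw [hT]
    exact h
  | j + 4, hjm, _ =>
    have hr := hω.mul ((hσ ⟨j, by omega⟩).mul (hσ ⟨j + 1, by omega⟩))
    have h := hr.mul (hr.mul hr)
    have hT : linMap (n := n) hm hmn ⟨j + 4, hjm⟩ = fun p =>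
        sigmaParams ⟨j + 1, by omega⟩ (sigmaParams ⟨j, by omega⟩ (swapParams
          (sigmaParams ⟨j + 1, by omega⟩ (sigmaParams ⟨j, by omega⟩ (swapParams
            (sigmaParams ⟨j + 1, by omega⟩ (sigmaParams ⟨j, by omega⟩ (swapParams p)))))))) := by
      funext p
      rw [sigmaParams_comp (by simp), sigmaParams_comp (by simp), sigmaParams_comp (by simp)]
      refine Prod.ext (funext fun a => ?_) (funext fun i => ?_)
      · fin_cases a
        · simp [linMap, swapParams]
          ring
        · simp [linMap, swapParams]
          ring
      · by_cases h3 : i = ⟨j + 3, by omega⟩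
        · subst h3
          simp [linMap, swapParams]
          ring
        · by_cases h4 : i = ⟨j + 4, by omega⟩
          · subst h4
            simp [linMap, swapParams]
            ring
          · simp [linMap, swapParams, h3, h4, Equiv.swap_apply_of_ne_of_ne h3 h4]
    rw [hT]
    exact h

/-! ### The subspaces of parameters and the sets of regular parameters -/

section Generic

variable {n : ℕ}

/-- Translation of the parameter `h_a`. -/
def hDir (n : ℕ) (a : Fin 2) : Params n := (Pi.single a 1, 0)

/-- Translation of the parameter `k_i`. -/
def kDir {n : ℕ} (i : Fin (n + 3)) : Params n := (0, Pi.single i 1)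

lemma add_hDir_h_same (p : Params n) (a : Fin 2) (t : ℂ) :
    (p + t • hDir n a).1 a = p.1 a + t := by simp [hDir]

lemma add_hDir_h_ne (p : Params n) {a b : Fin 2} (hab : b ≠ a) (t : ℂ) :
    (p + t • hDir n a).1 b = p.1 b := by simp [hDir, hab]

lemma add_hDir_k (p : Params n) (a : Fin 2) (t : ℂ) : (p + t • hDir n a).2 = p.2 := by
  simp [hDir]

lemma add_kDir_k_same (p : Params n) (i : Fin (n + 3)) (t : ℂ) :
    (p + t • kDir i).2 i = p.2 i + t := by simp [kDir]

lemma add_kDir_k_ne (p : Params n) {i j : Fin (n + 3)} (hij : j ≠ i) (t : ℂ) :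
    (p + t • kDir i).2 j = p.2 j := by simp [kDir, hij]

lemma ne_addNat_three {k : Fin (n + 3)} (hk : (k : ℕ) < 3) (i : Fin n) : k ≠ i.addNat 3 := by
  rintro rfl
  simp at hk

lemma two_ne_zero_fin : (2 : Fin (n + 3)) ≠ 0 := fun h => by
  have := congrArg Fin.val h
  change 2 % (n + 3) = 0 at this
  rw [Nat.mod_eq_of_lt (by omega)] at this
  omega

lemma two_ne_one_fin : (2 : Fin (n + 3)) ≠ 1 := fun h => by
  have := congrArg Fin.val h
  change 2 % (n + 3) = 1 % (n + 3) at this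
  rw [Nat.mod_eq_of_lt (by omega), Nat.mod_eq_of_lt (by omega)] at this
  omega

lemma paramsII_add_hDir (a : Fin 2) : ∀ p ∈ paramsII n, ∀ t : ℂ, p + t • hDir n a ∈ paramsII n := by
  intro p hp t
  rwa [paramsII, Set.mem_ofPred_eq, add_hDir_k]

lemma paramsIV_add_hDir (a : Fin 2) : ∀ p ∈ paramsIV n, ∀ t : ℂ, p + t • hDir n a ∈ paramsIV n := by
  intro p hp t
  rwa [paramsIV, Set.mem_ofPred_eq, add_hDir_k]

lemma paramsII_add_kDir {i : Fin (n + 3)} (h0 : i ≠ 0) (h1 : i ≠ 1) :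
    ∀ p ∈ paramsII n, ∀ t : ℂ, p + t • kDir i ∈ paramsII n := by
  intro p hp t
  rwa [paramsII, Set.mem_ofPred_eq, add_kDir_k_ne p h0.symm, add_kDir_k_ne p h1.symm]

lemma paramsIV_add_kDir (i : Fin n) :
    ∀ p ∈ paramsIV n, ∀ t : ℂ, p + t • kDir (i.addNat 3) ∈ paramsIV n := by
  intro p hp t
  rwa [paramsIV, Set.mem_ofPred_eq, add_kDir_k_ne p (ne_addNat_three zero_lt_three i),
    add_kDir_k_ne p (ne_addNat_three one_lt_three i),
    add_kDir_k_ne p (ne_addNat_three two_lt_three i)]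

lemma paramsII_add_kDir_addNat (i : Fin n) :
    ∀ p ∈ paramsII n, ∀ t : ℂ, p + t • kDir (i.addNat 3) ∈ paramsII n :=
  paramsII_add_kDir (ne_addNat_three zero_lt_three i).symm (ne_addNat_three one_lt_three i).symm

variable {f : ℂ → ℂ} (hf : SigmaLike f) {V : Set (Params n)}
include hf

lemma relOpenDense_h (a : Fin 2) (hV : ∀ p ∈ V, ∀ t : ℂ, p + t • hDir n a ∈ V)
    {l : Params n → ℂ} (hl : Continuous l) (hlv : ∀ p t, l (p + t • hDir n a) = l p + 1 * t) :
    RelOpenDense V {p | f (l p) ≠ 0} :=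
  hf.relOpenDense hl (hDir n a) one_ne_zero hV hlv

lemma relOpenDense_k (i : Fin (n + 3)) (hV : ∀ p ∈ V, ∀ t : ℂ, p + t • kDir i ∈ V)
    {l : Params n → ℂ} (hl : Continuous l) (hlv : ∀ p t, l (p + t • kDir i) = l p + 1 * t) :
    RelOpenDense V {p | f (l p) ≠ 0} :=
  hf.relOpenDense hl (kDir i) one_ne_zero hV hlv

lemma relOpenDense_h_sub_k (hV : ∀ a, ∀ p ∈ V, ∀ t : ℂ, p + t • hDir n a ∈ V) (a : Fin 2)
    (i j : Fin (n + 3)) : RelOpenDense V {p | f (p.1 a - p.2 i - p.2 j) ≠ 0} :=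
  relOpenDense_h hf a (hV a) (by fun_prop) fun p t => by
    rw [add_hDir_h_same, add_hDir_k]
    ring

lemma relOpenDense_h_sub_two (hV : ∀ a, ∀ p ∈ V, ∀ t : ℂ, p + t • hDir n a ∈ V) (a : Fin 2)
    (i : Fin (n + 3)) : RelOpenDense V {p | f (p.1 a - 2 * p.2 i) ≠ 0} :=
  relOpenDense_h hf a (hV a) (by fun_prop) fun p t => by
    rw [add_hDir_h_same, add_hDir_k]
    ring

lemma relOpenDense_h_sub_h (hV : ∀ a, ∀ p ∈ V, ∀ t : ℂ, p + t • hDir n a ∈ V) :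
    RelOpenDense V {p | f (p.1 0 - p.1 1) ≠ 0} :=
  relOpenDense_h hf 0 (hV 0) (by fun_prop) fun p t => by
    rw [add_hDir_h_same, add_hDir_h_ne p (by simp)]
    ring

lemma relOpenDense_k_sub_k {i j : Fin (n + 3)} (hij : j ≠ i)
    (hV : ∀ p ∈ V, ∀ t : ℂ, p + t • kDir i ∈ V) :
    RelOpenDense V {p | f (p.2 i - p.2 j) ≠ 0} :=
  relOpenDense_k hf i hV (by fun_prop) fun p t => by
    rw [add_kDir_k_same, add_kDir_k_ne p hij]
    ring

lemma relOpenDense_h_add_h (hV : ∀ a, ∀ p ∈ V, ∀ t : ℂ, p + t • hDir n a ∈ V)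
    (i₁ i₂ i₃ i₄ : Fin (n + 3)) :
    RelOpenDense V {p | f (p.1 0 + p.1 1 - p.2 i₁ - p.2 i₂ - p.2 i₃ - p.2 i₄) ≠ 0} :=
  relOpenDense_h hf 0 (hV 0) (by fun_prop) fun p t => by
    rw [add_hDir_h_same, add_hDir_h_ne p (by simp), add_hDir_k]
    ring

lemma relOpenDense_regularII : RelOpenDense (paramsII n) (regularII f n) := by
  have h1 := relOpenDense_k_sub_k hf two_ne_zero_fin.symm
    (paramsII_add_kDir (n := n) two_ne_zero_fin two_ne_one_fin)
  have h2 := RelOpenDense.forall_fintype fun a =>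
    relOpenDense_h_sub_k hf (paramsII_add_hDir (n := n)) a 0 2
  have h3 := RelOpenDense.forall_fintype fun i : Fin n =>
    (relOpenDense_k_sub_k hf (ne_addNat_three zero_lt_three i) (paramsII_add_kDir_addNat i)).inter
      (RelOpenDense.forall_fintype fun a =>
        relOpenDense_h_sub_k hf (paramsII_add_hDir (n := n)) a 0 (i.addNat 3))
  exact (h1.inter (h2.inter h3)).congr fun p _ => Iff.rfl

lemma relOpenDense_regularIV : RelOpenDense (paramsIV n) (regularIV f n) := by
  have h2 := RelOpenDense.forall_fintype fun a =>
    relOpenDense_h_sub_two hf (paramsIV_add_hDir (n := n)) a 2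
  have h3 := RelOpenDense.forall_fintype fun i : Fin n =>
    (relOpenDense_k_sub_k hf (ne_addNat_three two_lt_three i) (paramsIV_add_kDir i)).inter
      (RelOpenDense.forall_fintype fun a =>
        relOpenDense_h_sub_k hf (paramsIV_add_hDir (n := n)) a 2 (i.addNat 3))
  exact (h2.inter h3).congr fun p _ => Iff.rfl

/-! ### The realizations of `ω` -/

lemma realizes_omega_II :
    Realizes (paramsII n) (regularII f n) (substII f) omegaMap swapParams where
  mapsTo _ hp := hp
  preimage A hA := hA.preimage continuous_swapParams swapParams_swapParams fun _ hp => hp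
  domain := (relOpenDense_regularII hf).congr fun p _ => by simp [omegaMap]
  map p _ hr _ := by
    refine ⟨⟨hr.1, fun a => ?_, fun i => ⟨(hr.2.2 i).1, fun a => ?_⟩⟩, ?_⟩
    · fin_cases a
      exacts [hr.2.1 1, hr.2.1 0]
    · fin_cases a
      exacts [(hr.2.2 i).2 1, (hr.2.2 i).2 0]
    · exact Part.mem_some _

lemma realizes_omega_IV :
    Realizes (paramsIV n) (regularIV f n) (substIV f) omegaMap swapParams where
  mapsTo _ hp := hp
  preimage A hA := hA.preimage continuous_swapParams swapParams_swapParams fun _ hp => hp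
  domain := (relOpenDense_regularIV hf).congr fun p _ => by simp [omegaMap]
  map p _ hr _ := by
    refine ⟨⟨fun a => ?_, fun i => ⟨(hr.2 i).1, fun a => ?_⟩⟩, ?_⟩
    · fin_cases a
      exacts [hr.1 1, hr.1 0]
    · fin_cases a
      exacts [(hr.2 i).2 1, (hr.2 i).2 0]
    · exact Part.mem_some _

/-! ### The realizations of `σ_j` -/

omit hf in
-- By uniqueness, a candidate for x̄_i is correct as soon as some ȳ_i completes it to a solution.
lemma mem_sigmaMap {S : System} {j : Fin n} {P Q : Config n} (hP : (sigmaMap S j P).Dom)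
    (hj : Q.1 j = P.1 j) (h2 : Q.2 = P.2)
    (hS : ∀ i, i ≠ j → ∃ v, S (P.2 j) (P.1 i) (Q.1 i) (P.1 j) (P.2 i) v) :
    Q ∈ sigmaMap S j P := by
  refine ⟨hP, Prod.ext (funext fun i => ?_) h2.symm⟩
  by_cases hi : i = j
  · subst hi
    simp [sigmaMap, hj]
  · obtain ⟨v, hv⟩ := hS i hi
    have := (hP i hi).choose_spec.2 (Q.1 i, v) hv
    simpa [sigmaMap, hi] using (congrArg Prod.fst this).symm

omit hf in
lemma sigmaParams_mem_paramsII (j : Fin n) :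
    ∀ p ∈ paramsII n, sigmaParams j p ∈ paramsII n := by
  intro p hp
  have hp : p.2 1 = p.2 0 := hp
  rw [paramsII, Set.mem_ofPred_eq, sigmaParams_k_zero, sigmaParams_k_one, hp]

omit hf in
lemma sigmaParams_mem_paramsIV (j : Fin n) :
    ∀ p ∈ paramsIV n, sigmaParams j p ∈ paramsIV n := by
  intro p hp
  have hp : p.2 0 = p.2 1 ∧ p.2 1 = p.2 2 := hp
  rw [paramsIV, Set.mem_ofPred_eq, sigmaParams_k_zero, sigmaParams_k_one, sigmaParams_k_two,
    hp.1, hp.2]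
  exact ⟨rfl, rfl⟩

lemma sigmaMap_II_dom_iff {j : Fin n} {p : Params n} (hr : p ∈ regularII f n) :
    (sigmaMap systemII j (substII f p)).Dom ↔ ∀ i, i ≠ j →
      f (p.1 0 - 2 * p.2 0) ≠ 0 ∧ f (p.1 1 - 2 * p.2 0) ≠ 0 ∧
      f (p.2 2 - p.2 (j.addNat 3)) ≠ 0 ∧ f (p.2 2 - p.2 (i.addNat 3)) ≠ 0 ∧
      f (p.1 0 - p.1 1) ≠ 0 ∧ f (p.2 (j.addNat 3) - p.2 (i.addNat 3)) ≠ 0 ∧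
      f (p.1 0 + p.1 1 - p.2 0 - p.2 2 - p.2 (j.addNat 3) - p.2 (i.addNat 3)) ≠ 0 := by
  refine forall₂_congr fun i _ => ?_
  rw [systemII_existsUnique_iff]
  exact hf.hatF_det_ne_zero_iff hr.1 (hr.2.1 0) (hr.2.1 1) (hr.2.2 j).1 (hr.2.2 i).1
    ((hr.2.2 j).2 0) ((hr.2.2 j).2 1) ((hr.2.2 i).2 0) ((hr.2.2 i).2 1)

lemma sigmaMap_IV_dom_iff {j : Fin n} {p : Params n} (hr : p ∈ regularIV f n) :
    (sigmaMap systemIV j (substIV f p)).Dom ↔ ∀ i, i ≠ j →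
      f (p.1 0 - p.1 1) ≠ 0 ∧ f (p.2 (j.addNat 3) - p.2 (i.addNat 3)) ≠ 0 ∧
      f (p.1 0 + p.1 1 - 2 * p.2 2 - p.2 (j.addNat 3) - p.2 (i.addNat 3)) ≠ 0 := by
  refine forall₂_congr fun i _ => ?_
  rw [systemIV_existsUnique_iff]
  exact hf.hathatF_det_ne_zero_iff ((hr.2 j).2 0) ((hr.2 j).2 1) ((hr.2 i).2 0) ((hr.2 i).2 1)

/-- The involution exchanges h₁ - A - P and h₁ - A - C up to sign; since ζ is odd, the four terms
are only permuted. -/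
lemma hatF_sigmaParams_self (A C P h₁ h₂ : ℂ) :
    hatF f (A - h₂) (C - h₂) (P - h₂) (A + A + C + P - h₁ - 2 * h₂) = hatF f A C P h₁ := by
  have e1 : A + A + C + P - h₁ - 2 * h₂ - (A - h₂) - (C - h₂) = -(h₁ - A - P) := by ring
  have e2 : A + A + C + P - h₁ - 2 * h₂ - (A - h₂) - (P - h₂) = -(h₁ - A - C) := by ring
  simp only [hatF, sub_sub_sub_cancel_right, e1, e2, hf.zetaFn_neg]
  ring

lemma hatF_sigmaParams_of_ne (A C P Q h₁ h₂ : ℂ) :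
    hatF f (A - h₂) (C - h₂) (-Q) (A + A + C + P - h₁ - 2 * h₂) = barII f A C P Q h₁ h₂ := by
  have e1 : A + A + C + P - h₁ - 2 * h₂ - (A - h₂) - (C - h₂) = -(h₁ - A - P) := by ring
  have e2 : A + A + C + P - h₁ - 2 * h₂ - (A - h₂) - -Q = -(h₁ + h₂ - A - C - P - Q) := by ring
  have e3 : -Q - (A - h₂) = h₂ - A - Q := by ring
  simp only [hatF, barII, sub_sub_sub_cancel_right, e1, e2, e3, hf.zetaFn_neg]
  ring

lemma hathatF_sigmaParams_self (A P h₁ h₂ : ℂ) :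
    hathatF f (A - h₂) (P - h₂) (A + A + A + P - h₁ - 2 * h₂) = hathatF f A P h₁ := by
  have e1 : A + A + A + P - h₁ - 2 * h₂ - 2 * (A - h₂) = -(h₁ - A - P) := by ring
  have e2 : A + A + A + P - h₁ - 2 * h₂ - (A - h₂) - (P - h₂) = -(h₁ - 2 * A) := by ring
  simp only [hathatF, sub_sub_sub_cancel_right, e1, e2, hf.zetaFn_neg]
  ring

lemma hathatF_sigmaParams_of_ne (A P Q h₁ h₂ : ℂ) :
    hathatF f (A - h₂) (-Q) (A + A + A + P - h₁ - 2 * h₂) = barIV f A P Q h₁ h₂ := by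
  have e1 : A + A + A + P - h₁ - 2 * h₂ - 2 * (A - h₂) = -(h₁ - A - P) := by ring
  have e2 : A + A + A + P - h₁ - 2 * h₂ - (A - h₂) - -Q = -(h₁ + h₂ - 2 * A - P - Q) := by ring
  have e3 : -Q - (A - h₂) = h₂ - A - Q := by ring
  simp only [hathatF, barIV, e1, e2, e3, hf.zetaFn_neg]
  ring

lemma realizes_sigma_II (j : Fin n) :
    Realizes (paramsII n) (regularII f n) (substII f) (sigmaMap systemII j) (sigmaParams j) where
  mapsTo := sigmaParams_mem_paramsII j
  preimage A hA := hA.preimage (continuous_sigmaParams j) (sigmaParams_sigmaParams j)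
    (sigmaParams_mem_paramsII j)
  domain := by
    have hV := paramsII_add_hDir (n := n)
    have h := (relOpenDense_regularII hf).inter (RelOpenDense.forall_fintype fun i : Fin n =>
      RelOpenDense.imp fun hij : i ≠ j =>
        (relOpenDense_h_sub_two hf hV 0 0).inter <| (relOpenDense_h_sub_two hf hV 1 0).inter <|
        (relOpenDense_k_sub_k hf (ne_addNat_three two_lt_three j).symm
          (paramsII_add_kDir two_ne_zero_fin two_ne_one_fin)).inter <|
        (relOpenDense_k_sub_k hf (ne_addNat_three two_lt_three i).symm
          (paramsII_add_kDir two_ne_zero_fin two_ne_one_fin)).inter <|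
        (relOpenDense_h_sub_h hf hV).inter <|
        (relOpenDense_k_sub_k hf (addNat_three_ne hij) (paramsII_add_kDir_addNat j)).inter <|
        relOpenDense_h_add_h hf hV 0 2 (j.addNat 3) (i.addNat 3))
    refine h.congr fun p _ => and_congr_right fun hr => ?_
    rw [sigmaMap_II_dom_iff hf hr]
    rfl
  map p hp hr hd := by
    have hdom := (sigmaMap_II_dom_iff hf hr).mp hd
    have hp : p.2 1 = p.2 0 := hp
    obtain ⟨hCA, hC, hk⟩ := hr
    have hneg : ∀ {z w : ℂ}, w = -z → f z ≠ 0 → f w ≠ 0 := fun h hz => by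
      rwa [h, hf.neg, neg_ne_zero]
    have heq : ∀ {z w : ℂ}, w = z → f z ≠ 0 → f w ≠ 0 := fun h hz => by rwa [h]
    constructor
    -- Up to sign, every form tested at the image is one tested at p, except h₁ + h₂ - A - C - P -
    -- Q. Its nonvanishing is the last factor in the determinacy condition.
    · refine ⟨?_, fun a => ?_, fun i => ⟨?_, fun a => ?_⟩⟩
      · rw [sigmaParams_k_zero, sigmaParams_k_two]
        exact heq (by ring) hCA
      · rw [sigmaParams_k_zero, sigmaParams_k_two]
        fin_cases a
        · refine hneg ?_ ((hk j).2 0)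
          change (sigmaParams j p).1 0 - _ - _ = _
          rw [sigmaParams_h_zero, hp]
          ring
        · refine heq ?_ (hC 1)
          change (sigmaParams j p).1 1 - _ - _ = _
          rw [sigmaParams_h_one]
          ring
      · rw [sigmaParams_k_zero]
        by_cases hij : i = j
        · subst hij
          rw [sigmaParams_k_self]
          exact heq (by ring) (hk i).1
        · rw [sigmaParams_k_of_ne _ hij]
          exact heq (by ring) ((hk i).2 1)
      · rw [sigmaParams_k_zero]
        by_cases hij : i = j
        · subst hij
          rw [sigmaParams_k_self]
          fin_cases a
          · refine hneg ?_ (hC 0)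
            change (sigmaParams i p).1 0 - _ - _ = _
            rw [sigmaParams_h_zero, hp]
            ring
          · refine heq ?_ ((hk i).2 1)
            change (sigmaParams i p).1 1 - _ - _ = _
            rw [sigmaParams_h_one]
            ring
        · rw [sigmaParams_k_of_ne _ hij]
          fin_cases a
          · refine hneg ?_ (hdom i hij).2.2.2.2.2.2
            change (sigmaParams j p).1 0 - _ - _ = _
            rw [sigmaParams_h_zero, hp]
            ring
          · refine heq ?_ (hk i).1
            change (sigmaParams j p).1 1 - _ - _ = _
            rw [sigmaParams_h_one]
            ring
    · refine mem_sigmaMap hd ?_ (funext fun i => ?_) fun i hij => ?_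
      · simp only [substII, sigmaParams_k_zero, sigmaParams_k_two, sigmaParams_k_self,
          sigmaParams_h_zero, hp, hatF_sigmaParams_self hf]
      · by_cases hij : i = j
        · subst hij
          simp only [substII, hatF, sigmaParams_k_zero, sigmaParams_k_two, sigmaParams_k_self,
            sigmaParams_h_one, sub_sub_sub_cancel_right]
          ring_nf
        -- For i ≠ j the arguments k_{i+3} - k₁ and h₂ - k₁ - k_{i+3} change places, which leaves
        -- y_i unaltered.
        · simp only [substII, hatF, sigmaParams_k_zero, sigmaParams_k_two,
            sigmaParams_k_of_ne _ hij, sigmaParams_h_one, sub_sub_sub_cancel_right]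
          ring_nf
      -- The value of ȳ_i is that of x̄_i with h₁ and h₂ interchanged.
      · refine ⟨barII f (p.2 0) (p.2 2) (p.2 (j.addNat 3)) (p.2 (i.addNat 3)) (p.1 1) (p.1 0), ?_⟩
        have hx : (substII f (sigmaParams j p)).1 i =
            barII f (p.2 0) (p.2 2) (p.2 (j.addNat 3)) (p.2 (i.addNat 3)) (p.1 0) (p.1 1) := by
          simp only [substII, sigmaParams_k_zero, sigmaParams_k_two,
            sigmaParams_k_of_ne _ hij, sigmaParams_h_zero, hp, hatF_sigmaParams_of_ne hf]
        rw [hx]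
        exact hf.systemII_hatF hCA (hC 0) (hC 1) (hk j).1 (hk i).1 ((hk j).2 0) ((hk j).2 1)
          ((hk i).2 0) ((hk i).2 1) (hdom i hij).2.2.2.2.2.2

lemma realizes_sigma_IV (j : Fin n) :
    Realizes (paramsIV n) (regularIV f n) (substIV f) (sigmaMap systemIV j) (sigmaParams j) where
  mapsTo := sigmaParams_mem_paramsIV j
  preimage A hA := hA.preimage (continuous_sigmaParams j) (sigmaParams_sigmaParams j)
    (sigmaParams_mem_paramsIV j)
  domain := by
    have hV := paramsIV_add_hDir (n := n)
    have h := (relOpenDense_regularIV hf).inter (RelOpenDense.forall_fintype fun i : Fin n =>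
      RelOpenDense.imp fun hij : i ≠ j =>
        (relOpenDense_h_sub_h hf hV).inter <|
        (relOpenDense_k_sub_k hf (addNat_three_ne hij) (paramsIV_add_kDir j)).inter <|
        relOpenDense_h_add_h hf hV 2 2 (j.addNat 3) (i.addNat 3))
    refine h.congr fun p _ => and_congr_right fun hr => ?_
    rw [sigmaMap_IV_dom_iff hf hr]
    simp only [two_mul, ← sub_sub]
    rfl
  map p hp hr hd := by
    have hdom := (sigmaMap_IV_dom_iff hf hr).mp hd
    have hp1 : p.2 1 = p.2 2 := hp.2
    have hp0 : p.2 0 = p.2 2 := hp.1.trans hp.2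
    obtain ⟨hA, hk⟩ := hr
    have hneg : ∀ {z w : ℂ}, w = -z → f z ≠ 0 → f w ≠ 0 := fun h hz => by
      rwa [h, hf.neg, neg_ne_zero]
    have heq : ∀ {z w : ℂ}, w = z → f z ≠ 0 → f w ≠ 0 := fun h hz => by rwa [h]
    constructor
    · refine ⟨fun a => ?_, fun i => ⟨?_, fun a => ?_⟩⟩
      · rw [sigmaParams_k_two]
        fin_cases a
        · refine hneg ?_ ((hk j).2 0)
          change (sigmaParams j p).1 0 - _ = _
          rw [sigmaParams_h_zero, hp0, hp1]
          ring
        · refine heq ?_ (hA 1)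
          change (sigmaParams j p).1 1 - _ = _
          rw [sigmaParams_h_one]
          ring
      · rw [sigmaParams_k_two]
        by_cases hij : i = j
        · subst hij
          rw [sigmaParams_k_self]
          exact heq (by ring) (hk i).1
        · rw [sigmaParams_k_of_ne _ hij]
          exact heq (by ring) ((hk i).2 1)
      · rw [sigmaParams_k_two]
        by_cases hij : i = j
        · subst hij
          rw [sigmaParams_k_self]
          fin_cases a
          · refine hneg ?_ (hA 0)
            change (sigmaParams i p).1 0 - _ - _ = _
            rw [sigmaParams_h_zero, hp0, hp1]
            ring
          · refine heq ?_ ((hk i).2 1)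
            change (sigmaParams i p).1 1 - _ - _ = _
            rw [sigmaParams_h_one]
            ring
        · rw [sigmaParams_k_of_ne _ hij]
          fin_cases a
          · refine hneg ?_ (hdom i hij).2.2
            change (sigmaParams j p).1 0 - _ - _ = _
            rw [sigmaParams_h_zero, hp0, hp1]
            ring
          · refine heq ?_ (hk i).1
            change (sigmaParams j p).1 1 - _ - _ = _
            rw [sigmaParams_h_one]
            ring
    · refine mem_sigmaMap hd ?_ (funext fun i => ?_) fun i hij => ?_
      · simp only [substIV, sigmaParams_k_two, sigmaParams_k_self, sigmaParams_h_zero, hp0, hp1,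
          hathatF_sigmaParams_self hf]
      · by_cases hij : i = j
        · subst hij
          simp only [substIV, hathatF, sigmaParams_k_two, sigmaParams_k_self,
            sigmaParams_h_one, sub_sub_sub_cancel_right]
          ring_nf
        · simp only [substIV, hathatF, sigmaParams_k_two, sigmaParams_k_of_ne _ hij,
            sigmaParams_h_one]
          ring_nf
      · refine ⟨barIV f (p.2 2) (p.2 (j.addNat 3)) (p.2 (i.addNat 3)) (p.1 1) (p.1 0), ?_⟩
        have hx : (substIV f (sigmaParams j p)).1 i =
            barIV f (p.2 2) (p.2 (j.addNat 3)) (p.2 (i.addNat 3)) (p.1 0) (p.1 1) := by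
          simp only [substIV, sigmaParams_k_two, sigmaParams_k_of_ne _ hij, sigmaParams_h_zero,
            hp0, hp1, hathatF_sigmaParams_of_ne hf]
        rw [hx]
        exact hf.systemIV_hathatF (hA 0) (hA 1) (hk j).1 (hk i).1 ((hk j).2 0) ((hk j).2 1)
          ((hk i).2 0) ((hk i).2 1) (hdom i hij).2.2

end Generic

end TripletPair

/-! ### Assembly of the theorem -/

theorem mainTheorem2 (f : ℂ → ℂ) (hf : IsBracket f) :
    (∀ k₁ k₃ u h : ℂ, f (k₃ - k₁) ≠ 0 → f (h - k₁ - k₃) ≠ 0 → f (u - k₁) ≠ 0 →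
      f (h - k₁ - u) ≠ 0 →
      (fun k₂ : ℂ => bigF f k₁ k₂ k₃ u h - (1 + (k₂ - k₁) * hatF f k₁ k₃ u h))
        =O[𝓝 k₁] fun k₂ : ℂ => (k₂ - k₁) ^ 2) ∧
    (∀ k₃ u h : ℂ, f (h - 2 * k₃) ≠ 0 → f (u - k₃) ≠ 0 → f (h - k₃ - u) ≠ 0 →
      (fun k₁ : ℂ => hatF f k₁ k₃ u h - (1 / (k₃ - k₁) + hathatF f k₃ u h))
        =O[𝓝[≠] k₃] fun k₁ : ℂ => k₃ - k₁) ∧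
    (∀ k₃ u h : ℂ, f (u - k₃) ≠ 0 → f (h - k₃ - u) ≠ 0 →
      wpFn f (u - k₃) ≠ wpFn f (h - k₃ - u) →
      hathatF f k₃ u h =
        1 / 2 * ((deriv (wpFn f) (u - k₃) - deriv (wpFn f) (h - k₃ - u)) /
          (wpFn f (u - k₃) - wpFn f (h - k₃ - u)))) ∧
    ∀ (m n : ℕ) (hm : 1 < m) (hmn : m ≤ n) (j : Fin (m + 3)), j ≠ 0 →
      Compatible (paramsII n) (regularII f n) (substII f)
        (tMap hm hmn systemII j) (linMap hm hmn j) ∧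
      Compatible (paramsIV n) (regularIV f n) (substIV f)
        (tMap hm hmn systemIV j) (linMap hm hmn j) := by
  have hs := hf.sigmaLike
  refine ⟨fun k₁ k₃ u h => hs.bigF_isBigO, fun k₃ u h => hs.hatF_isBigO,
    fun k₃ u h => hs.hathatF_eq, fun m n hm hmn j hj => ⟨?_, ?_⟩⟩
  · exact (Realizes.tMap hm hmn (realizes_omega_II hs) (realizes_sigma_II hs) hj).compatible
  · exact (Realizes.tMap hm hmn (realizes_omega_IV hs) (realizes_sigma_IV hs) hj).compatible
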